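/- **Theorem 2 (random vertex recovery).** *Model.* Let $V=\{1,\dots,n\}$. An adversary chooses $S\subseteq V$ with $|S|=k$. A random graph $G'=(V,E')$ is drawn in which each pair $\{u,v\}$ with $u\in S$, $v\notin S$ is an edge independently with probability $1/2$, and no other pair is an edge. Having seen $G'$, the adversary adds arbitrary edges $\{u,v\}$ that do not have both endpoints in $S$; the result is $G=(V,E)$. Finally a vertex $u_0$ is drawn uniformly from $S$, independently of $G'$ (and hence of $G$). *Algorithm.* The input is $(G,u_0)$; the algorithm knows neither $S$ nor $k$. 1. Take an optimal solution $(x_u)_{u\in V}$, $x_u\in\mathbb R^n$, of the crude SDP: minimize $\sum_{u,v\in V}\|x_u-x_v\|^2$ subject to $\|x_u\|^2=1$ for all $u$, $\langle x_u,x_v\rangle\ge 0$ for all $u,v$, and $\langle x_u,x_v\rangle=0$ for all $\{u,v\}\in E$. 2. For each $u\in V$ start with the set $\{v:\|x_v-x_u\|<1\}$ and extend it greedily: run through the vertices in increasing order, adding each vertex that is non-adjacent to all vertices already in the set. The list consists of the (distinct) sets so obtained that are independent in $G$. 3. Remove from the list all sets of size less than $n^{2/3}$. 4. Of the sets then on the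 list, remove every $S_1$ for which there is a set $S_2\neq S_1$ on the list with $|S_1\cap S_2|\ge\frac23|S_1|$. 5. For all sets $S_1\ne S_2$ then on the list with $|S_1\cap S_2|\ge 2\log_2 n$, remove both $S_1$ and $S_2$. 6. If $u_0$ lies in exactly one set that is still on the list, return this set; otherwise return FAIL. *Claim.* There is a constant $c_1>0$ such that, whenever $k\ge c_1n^{2/3}$, with high probability the algorithm returns exactly $S$. That is, for every $\delta>0$ there is an $N$ such that for all $n\ge N$, all $k\ge c_1n^{2/3}$, every $S\subseteq V$ with $|S|=k$, every strategy of the adversary for adding edges, and every choice of an optimal solution of the crude SDP in step 1, the probability over $G'$ and $u_0$ that the algorithm returns $S$ is at least $1-\delta$. -/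

import Mathlib

open MeasureTheory ProbabilityTheory

namespace SemirandomIndepSet

/-! ### The crude semidefinite program -/

/-- Assignments of a vector `x u ∈ ℝⁿ` to every vertex `u` of a graph on `n` vertices. -/
abbrev VectorAssignment (n : ℕ) : Type := Fin n → EuclideanSpace ℝ (Fin n)

/-- Feasibility for the crude SDP of `G`: unit vectors with pairwise non-negative inner products,
the vectors of adjacent vertices being orthogonal. -/
structure IsFeasible {n : ℕ} (G : SimpleGraph (Fin n)) (x : VectorAssignment n) : Prop where
  norm_sq_eq_one : ∀ u, ‖x u‖ ^ 2 = 1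
  inner_nonneg : ∀ u v, 0 ≤ inner ℝ (x u) (x v)
  inner_eq_zero : ∀ u v, G.Adj u v → inner ℝ (x u) (x v) = 0

/-- The objective of the crude SDP: the sum of `‖x u - x v‖²` over all ordered pairs. -/
noncomputable def objective {n : ℕ} (x : VectorAssignment n) : ℝ :=
  ∑ u, ∑ v, ‖x u - x v‖ ^ 2

/-- `x` is an optimal solution of the crude SDP of `G`. -/
structure IsOptimal {n : ℕ} (G : SimpleGraph (Fin n)) (x : VectorAssignment n) : Prop where
  feasible : IsFeasible G x
  objective_le : ∀ y, IsFeasible G y → objective x ≤ objective y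

/-- The crude SDP of every graph has an optimal solution. -/
theorem exists_isOptimal {n : ℕ} (G : SimpleGraph (Fin n)) : ∃ x, IsOptimal G x := by
  have hne : ∃ x, IsFeasible G x := by
    have hin : ∀ u v : Fin n, inner ℝ (EuclideanSpace.single u (1 : ℝ))
        (EuclideanSpace.single v (1 : ℝ)) = if u = v then (1 : ℝ) else 0 := fun u v => by
      simp [EuclideanSpace.inner_single_left]
    refine ⟨fun u => EuclideanSpace.single u 1, ⟨fun u => by simp, fun u v => ?_, fun u v h => ?_⟩⟩
    · rw [hin]; split_ifs <;> norm_num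
    · rw [hin, if_neg h.ne]
  have hcl : IsClosed {x : VectorAssignment n | IsFeasible G x} := by
    have : {x : VectorAssignment n | IsFeasible G x} =
        (⋂ u, {x | ‖x u‖ ^ 2 = 1}) ∩ ((⋂ u, ⋂ v, {x | 0 ≤ inner ℝ (x u) (x v)}) ∩
          (⋂ u, ⋂ v, ⋂ _ : G.Adj u v, {x | inner ℝ (x u) (x v) = 0})) := by
      ext x
      simp only [Set.mem_inter_iff, Set.mem_iInter, Set.mem_ofPred_eq]
      exact ⟨fun h => ⟨h.1, h.2, h.3⟩, fun h => ⟨h.1, h.2.1, h.2.2⟩⟩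
    rw [this]
    refine IsClosed.inter (isClosed_iInter fun u => ?_) (IsClosed.inter
      (isClosed_iInter fun u => isClosed_iInter fun v => ?_)
      (isClosed_iInter fun u => isClosed_iInter fun v => isClosed_iInter fun _ => ?_))
    · exact isClosed_eq (by fun_prop) (by fun_prop)
    · exact isClosed_le (by fun_prop) (by fun_prop)
    · exact isClosed_eq (by fun_prop) (by fun_prop)
  have hcomp : IsCompact {x : VectorAssignment n | IsFeasible G x} := by
    refine Metric.isCompact_of_isClosed_isBounded hcl
      (Metric.isBounded_closedBall (x := 0) (r := 1) |>.subset fun x hx => ?_)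
    rw [mem_closedBall_zero_iff, pi_norm_le_iff_of_nonneg zero_le_one]
    intro u
    have := hx.1 u
    nlinarith [norm_nonneg (x u)]
  have hcont : Continuous (objective (n := n)) := by
    unfold objective
    fun_prop
  obtain ⟨x, hx, hmin⟩ := hcomp.exists_isMinOn hne hcont.continuousOn
  exact ⟨x, hx, fun y hy => hmin hy⟩

/-! ### The candidate list -/

open scoped Classical in
/-- The vertices whose vectors are at distance less than `1` from the vector of `u`. -/
noncomputable def vertexBall {n : ℕ} (x : VectorAssignment n) (u : Fin n) : Finset (Fin n) :=
  Finset.univ.filter fun v => ‖x v - x u‖ < 1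

open scoped Classical in
/-- The greedy step: run through the vertices in increasing order, adding each vertex that is
non-adjacent to all vertices which are already in the set. -/
noncomputable def greedyExtend {n : ℕ} (G : SimpleGraph (Fin n)) (B : Finset (Fin n)) :
    Finset (Fin n) :=
  (List.finRange n).foldl (fun T v => if ∀ w ∈ T, ¬ G.Adj v w then insert v T else T) B

open scoped Classical in
/-- The candidate list: those greedily extended balls that are independent sets. -/
noncomputable def candidateList {n : ℕ} (G : SimpleGraph (Fin n)) (x : VectorAssignment n) :
    Finset (Finset (Fin n)) :=
  (Finset.univ.image fun u => greedyExtend G (vertexBall x u)).filter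
    fun T => G.IsIndepSet (T : Set (Fin n))

/-! ### Pruning -/

open scoped Classical in
/-- Remove the sets with fewer than `n ^ (2/3)` vertices. -/
noncomputable def removeSmall {n : ℕ} (L : Finset (Finset (Fin n))) : Finset (Finset (Fin n)) :=
  L.filter fun T => (n : ℝ) ^ (2 / 3 : ℝ) ≤ (T.card : ℝ)

open scoped Classical in
/-- Remove every set that shares at least two thirds of its vertices with another set of the
list. -/
noncomputable def removeMostlyCovered {n : ℕ} (L : Finset (Finset (Fin n))) :
    Finset (Finset (Fin n)) :=
  L.filter fun T => ∀ T' ∈ L, T ≠ T' → ((T ∩ T').card : ℝ) < 2 / 3 * (T.card : ℝ)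

open scoped Classical in
/-- Remove both members of every pair of distinct sets of the list that share at least
`2 log₂ n` vertices. -/
noncomputable def removeOverlapping {n : ℕ} (L : Finset (Finset (Fin n))) :
    Finset (Finset (Fin n)) :=
  L.filter fun T => ∀ T' ∈ L, T ≠ T' → ((T ∩ T').card : ℝ) < 2 * Real.logb 2 n

/-- The list which is left after the three removal steps. -/
noncomputable def prunedList {n : ℕ} (G : SimpleGraph (Fin n)) (x : VectorAssignment n) :
    Finset (Finset (Fin n)) :=
  removeOverlapping (removeMostlyCovered (removeSmall (candidateList G x)))

open scoped Classical in
/-- The output of the algorithm on the graph `G`, with `x` the solution found for the crude SDP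
of `G`, and on the given vertex `u`: the set on the pruned list that contains `u`, if there is
exactly one such set, and `none` (FAIL) otherwise. -/
noncomputable def recover {n : ℕ} (G : SimpleGraph (Fin n)) (x : VectorAssignment n)
    (u : Fin n) : Option (Finset (Fin n)) :=
  if h : ∃! T, T ∈ prunedList G x ∧ u ∈ T then some h.exists.choose else none

/-! ### The semi-random model -/

/-- The vertex pairs with one vertex in `S` and the other one outside `S`. -/
def boundary {n : ℕ} (S : Finset (Fin n)) : Set (Sym2 (Fin n)) :=
  {e | ∃ u ∈ S, ∃ v ∉ S, e = s(u, v)}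

/-- The probability `1/2`, as an element of the unit interval. -/
noncomputable def half : unitInterval := ⟨1 / 2, by norm_num, by norm_num⟩

/-- The law of the random graph `G'`: each pair of vertices with exactly one of them in `S` is an
edge with probability `1/2`, independently of the others, and no other pair is an edge. -/
noncomputable def randomGraph {n : ℕ} (S : Finset (Fin n)) : Measure (SimpleGraph (Fin n)) :=
  (setBernoulli (boundary S) half).map SimpleGraph.fromEdgeSet

/-- `A` is a strategy of the adversary: from a graph `H`, the adversary produces `A H` by adding
edges arbitrarily, except for pairs with both vertices in `S`. -/
def IsAdversary {n : ℕ} (S : Finset (Fin n))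
    (A : SimpleGraph (Fin n) → SimpleGraph (Fin n)) : Prop :=
  ∀ H, H ≤ A H ∧ ∀ u ∈ S, ∀ v ∈ S, (A H).Adj u v → H.Adj u v

/-- The joint law of the random graph `G'` and of an independent, uniformly random vertex
of `S`. -/
noncomputable def inputLaw {n : ℕ} (S : Finset (Fin n)) :
    Measure (SimpleGraph (Fin n) × Fin n) :=
  (randomGraph S).prod (uniformOn (S : Set (Fin n)))

end SemirandomIndepSet

/-! Collapsing all of `S` to one unit vector orthogonal to the other vectors gives a feasible
solution. Comparing it with an optimal one bounds the total defect `1 - ⟨x u, x v⟩` over `S × S` by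
twice the sum of the inner products between `S` and its complement. Inner products vanish on edges,
so that sum is unchanged when each pair is multiplied by its random sign in `G'`. It is then a form
of a random sign matrix, whose norm is `O(√n)` by a net argument, and so it is `O(n √|S|)`
(`IsFeasible.sum_edgeSign_mul_inner_le`). For `|S| ≥ c n^(2/3)` this is a small fraction of `|S|²`,
so some `u ∈ S` is close to most of `S`. Every outside vertex has a neighbour among those close
vertices, and this forces the greedily extended ball of `u` to be `S`
(`IsOptimal.mem_candidateList`).

Pruning keeps `S`: any other candidate contains an outside vertex, hence misses more than a third of
`S`; a candidate not mostly covered by `S` has many vertices outside `S`, hence meets `S` in fewer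
than `2 log₂ n` vertices, since there is no large empty bipartite graph across the cut. The
surviving sets are large and nearly disjoint, so there are only `O(n^(1/3))` of them
(`card_le_of_inter_le`), and they cover `O(n^(1/3) log n) = o(|S|)` vertices of `S`. A random `u₀`
avoids them with high probability.

All random input is a property of `G'` alone (`IsGoodGraph`), so the adversary's additions and the
choice of optimal solution are handled deterministically. -/

namespace SemirandomIndepSet

/-! ### The pruning steps on pseudorandom graphs -/

section

open scoped Classical in
/-- One step of the greedy extension. -/
noncomputable def greedyStep {n : ℕ} (G : SimpleGraph (Fin n)) (T : Finset (Fin n)) (v : Fin n) :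
    Finset (Fin n) :=
  if ∀ w ∈ T, ¬ G.Adj v w then insert v T else T

/-! ### Greedy extension: maximality and recovery of an independent set. -/

section Greedy

variable {n : ℕ} {G : SimpleGraph (Fin n)}

theorem subset_greedyStep (T : Finset (Fin n)) (v : Fin n) : T ⊆ greedyStep G T v := by
  classical
  unfold greedyStep
  split_ifs
  · exact Finset.subset_insert _ _
  · exact subset_rfl

theorem subset_foldl_greedyStep (l : List (Fin n)) (B : Finset (Fin n)) :
    B ⊆ l.foldl (greedyStep G) B := by
  induction l generalizing B with
  | nil => exact subset_rfl
  | cons v l ih => exact (subset_greedyStep B v).trans (ih _)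

/-- The set only grows, so the neighbour that causes `v` to be rejected is still present at the end.
-/
theorem mem_foldl_greedyStep_or (l : List (Fin n)) (B : Finset (Fin n)) {v : Fin n} (hv : v ∈ l) :
    v ∈ l.foldl (greedyStep G) B ∨ ∃ w ∈ l.foldl (greedyStep G) B, G.Adj v w := by
  classical
  induction l generalizing B with
  | nil => simp at hv
  | cons a l ih =>
    rcases List.mem_cons.1 hv with rfl | hv
    · have hsub := subset_foldl_greedyStep (G := G) l (greedyStep G B v)
      by_cases h : ∀ w ∈ B, ¬ G.Adj v w
      · refine Or.inl (hsub ?_)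
        rw [greedyStep, if_pos h]
        exact Finset.mem_insert_self _ _
      · push Not at h
        obtain ⟨w, hw, hvw⟩ := h
        exact Or.inr ⟨w, hsub (subset_greedyStep B v hw), hvw⟩
    · exact ih _ hv

theorem mem_greedyExtend_or (B : Finset (Fin n)) (v : Fin n) :
    v ∈ greedyExtend G B ∨ ∃ w ∈ greedyExtend G B, G.Adj v w :=
  mem_foldl_greedyStep_or _ _ (List.mem_finRange v)

theorem foldl_greedyStep_subset {S : Finset (Fin n)} (l : List (Fin n)) {B : Finset (Fin n)}
    (hB : B ⊆ S) (hout : ∀ v ∉ S, ∃ w ∈ B, G.Adj v w) : l.foldl (greedyStep G) B ⊆ S := by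
  classical
  induction l generalizing B with
  | nil => exact hB
  | cons a l ih =>
    refine ih ?_ fun v hv => ?_
    · unfold greedyStep
      split_ifs with h
      · refine Finset.insert_subset ?_ hB
        by_contra ha
        obtain ⟨w, hw, haw⟩ := hout a ha
        exact h w hw haw
      · exact hB
    · obtain ⟨w, hw, hvw⟩ := hout v hv
      exact ⟨w, subset_greedyStep B a hw, hvw⟩

/-- A vertex left out has a neighbour in the extension; inside an independent set this is
impossible. -/
theorem eq_of_subset_of_isIndepSet {S B : Finset (Fin n)} (hS : G.IsIndepSet (S : Set (Fin n)))
    (h : greedyExtend G B ⊆ S) : greedyExtend G B = S := by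
  refine h.antisymm fun v hv => ?_
  rcases mem_greedyExtend_or (G := G) B v with h' | ⟨w, hw, hvw⟩
  · exact h'
  · exact absurd hvw (hS hv (h hw) hvw.ne)

/-- A set of which every outside vertex has a neighbour in `B ⊆ S` is recovered from `B`. -/
theorem greedyExtend_eq {S B : Finset (Fin n)} (hS : G.IsIndepSet (S : Set (Fin n)))
    (hB : B ⊆ S) (hout : ∀ v ∉ S, ∃ w ∈ B, G.Adj v w) : greedyExtend G B = S :=
  eq_of_subset_of_isIndepSet hS (foldl_greedyStep_subset _ hB hout)

end Greedy

/-! ### Pruning: survival of the planted set and the number of survivors. -/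

section Pruning

variable {n : ℕ} {G : SimpleGraph (Fin n)} {x : VectorAssignment n} {S : Finset (Fin n)}

open scoped Classical in
/-- The set `S` is independent, every other vertex sees more than a third of `S`, and there is no
large empty bipartite graph between `S` and its complement. -/
structure IsPseudorandom (G : SimpleGraph (Fin n)) (S : Finset (Fin n)) : Prop where
  isIndepSet : G.IsIndepSet (S : Set (Fin n))
  card_lt : ∀ v ∉ S, S.card < 3 * (S.filter fun u => G.Adj u v).card
  exists_adj : ∀ A ⊆ S, ∀ B ⊆ Sᶜ, 2 * Real.logb 2 n ≤ (A.card : ℝ) →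
    2 * Real.logb 2 n ≤ (B.card : ℝ) → ∃ a ∈ A, ∃ b ∈ B, G.Adj a b

theorem mem_candidateList {T : Finset (Fin n)} :
    T ∈ candidateList G x ↔
      (∃ u, greedyExtend G (vertexBall x u) = T) ∧ G.IsIndepSet (T : Set (Fin n)) := by
  simp [candidateList]

theorem mem_removeSmall {L : Finset (Finset (Fin n))} {T : Finset (Fin n)} :
    T ∈ removeSmall L ↔ T ∈ L ∧ (n : ℝ) ^ (2 / 3 : ℝ) ≤ (T.card : ℝ) := by
  simp [removeSmall]

theorem mem_removeMostlyCovered {L : Finset (Finset (Fin n))} {T : Finset (Fin n)} :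
    T ∈ removeMostlyCovered L ↔
      T ∈ L ∧ ∀ T' ∈ L, T ≠ T' → ((T ∩ T').card : ℝ) < 2 / 3 * (T.card : ℝ) := by
  classical
  simp only [removeMostlyCovered, Finset.mem_filter]

theorem mem_removeOverlapping {L : Finset (Finset (Fin n))} {T : Finset (Fin n)} :
    T ∈ removeOverlapping L ↔
      T ∈ L ∧ ∀ T' ∈ L, T ≠ T' → ((T ∩ T').card : ℝ) < 2 * Real.logb 2 n := by
  classical
  simp only [removeOverlapping, Finset.mem_filter]

theorem exists_notMem_of_mem_candidateList {T : Finset (Fin n)}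
    (hS : G.IsIndepSet (S : Set (Fin n))) (hT : T ∈ candidateList G x) (hne : T ≠ S) :
    ∃ v ∈ T, v ∉ S := by
  obtain ⟨⟨u, rfl⟩, -⟩ := mem_candidateList.1 hT
  by_contra! h
  exact hne (eq_of_subset_of_isIndepSet hS h)

/-- Being independent, `T` avoids all neighbours of a vertex of `T \ S`, and these make up more than
a third of `S`. -/
theorem IsPseudorandom.inter_lt (h : IsPseudorandom G S) {T : Finset (Fin n)}
    (hT : T ∈ candidateList G x) (hne : T ≠ S) :
    ((S ∩ T).card : ℝ) < 2 / 3 * (S.card : ℝ) := by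
  classical
  obtain ⟨v, hvT, hvS⟩ := exists_notMem_of_mem_candidateList h.isIndepSet hT hne
  have hind := (mem_candidateList.1 hT).2
  have h1 := h.card_lt v hvS
  have hdis : Disjoint (S ∩ T) (S.filter fun u => G.Adj u v) := by
    rw [Finset.disjoint_left]
    intro w hw hw'
    have hadj := (Finset.mem_filter.1 hw').2
    exact hind (Finset.mem_inter.1 hw).2 hvT hadj.ne hadj
  have h2 : (S ∩ T).card + (S.filter fun u => G.Adj u v).card ≤ S.card := by
    rw [← Finset.card_union_of_disjoint hdis]
    exact Finset.card_le_card
      (Finset.union_subset Finset.inter_subset_left (Finset.filter_subset _ _))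
  have h3 : 3 * (S ∩ T).card < 2 * S.card := by omega
  have h4 : (3 : ℝ) * ((S ∩ T).card : ℝ) < 2 * (S.card : ℝ) := by exact_mod_cast h3
  linarith

/-- Since `S` itself is on the list, `T` has more than a third of its vertices outside `S`, which is
at least `2 log₂ n` of them. If `S ∩ T` were as large, there would be an edge between the two parts
of the independent set `T`. -/
theorem IsPseudorandom.inter_lt_logb (h : IsPseudorandom G S)
    (hlog : 6 * Real.logb 2 n ≤ (n : ℝ) ^ (2 / 3 : ℝ))
    (hSL : S ∈ removeSmall (candidateList G x)) {T : Finset (Fin n)}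
    (hT : T ∈ removeMostlyCovered (removeSmall (candidateList G x))) (hne : T ≠ S) :
    ((S ∩ T).card : ℝ) < 2 * Real.logb 2 n := by
  classical
  by_contra! hge
  obtain ⟨hTL, hcov⟩ := mem_removeMostlyCovered.1 hT
  obtain ⟨hTc, hTn⟩ := mem_removeSmall.1 hTL
  have hind := (mem_candidateList.1 hTc).2
  have h1 := hcov S hSL hne
  have hsplit : ((T ∩ S).card : ℝ) + ((T \ S).card : ℝ) = (T.card : ℝ) := by
    exact_mod_cast Finset.card_inter_add_card_sdiff T S
  have hlarge : 2 * Real.logb 2 n ≤ ((T \ S).card : ℝ) := by linarith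
  obtain ⟨a, ha, b, hb, hab⟩ := h.exists_adj (S ∩ T) Finset.inter_subset_left (T \ S)
    (fun v hv => Finset.mem_compl.2 (Finset.mem_sdiff.1 hv).2) hge hlarge
  exact hind (Finset.mem_inter.1 ha).2 (Finset.mem_sdiff.1 hb).1 hab.ne hab

theorem IsPseudorandom.mem_prunedList (h : IsPseudorandom G S)
    (hlog : 6 * Real.logb 2 n ≤ (n : ℝ) ^ (2 / 3 : ℝ))
    (hSL : S ∈ removeSmall (candidateList G x)) : S ∈ prunedList G x := by
  refine mem_removeOverlapping.2 ⟨mem_removeMostlyCovered.2 ⟨hSL, fun T hT hne => ?_⟩,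
    fun T hT hne => h.inter_lt_logb hlog hSL hT hne.symm⟩
  exact h.inter_lt (mem_removeSmall.1 hT).1 hne.symm

/-- A family of large sets with small pairwise intersections is small. -/
theorem card_le_of_inter_le {L : Finset (Finset (Fin n))} {s r l m : ℝ} (hs : 0 < s)
    (hL : ∀ T ∈ L, s ≤ (T.card : ℝ))
    (hinter : ∀ T ∈ L, ∀ T' ∈ L, T ≠ T' → ((T ∩ T').card : ℝ) ≤ l)
    (hl : 0 ≤ l) (hr : r = n) (hm : 2 * r ≤ m * s) (hls : 2 * r * l < s ^ 2) :
    (L.card : ℝ) ≤ m := by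
  classical
  by_contra! hlt
  set σ : ℝ := ∑ T ∈ L, (T.card : ℝ) with hσ
  have hr0 : 0 ≤ r := hr ▸ Nat.cast_nonneg n
  have hσ1 : (L.card : ℝ) * s ≤ σ := by
    rw [hσ, ← nsmul_eq_mul]
    exact Finset.card_nsmul_le_sum _ _ _ hL
  -- Double counting: the first moment of the number of sets containing a vertex is the sum of the
  -- sizes, the second moment the sum of the pairwise intersections. Cauchy–Schwarz compares the
  -- two.
  have hdeg : σ = ∑ v : Fin n, ∑ T ∈ L, (if v ∈ T then (1 : ℝ) else 0) := by
    rw [Finset.sum_comm, hσ]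
    refine Finset.sum_congr rfl fun T _ => ?_
    simp
  have hsq : ∑ v : Fin n, (∑ T ∈ L, (if v ∈ T then (1 : ℝ) else 0)) ^ 2 =
      ∑ T ∈ L, ∑ T' ∈ L, ((T ∩ T').card : ℝ) := by
    simp_rw [sq, Finset.sum_mul_sum]
    rw [Finset.sum_comm]
    refine Finset.sum_congr rfl fun T _ => ?_
    rw [Finset.sum_comm]
    refine Finset.sum_congr rfl fun T' _ => ?_
    simp only [← ite_and, mul_ite, mul_one, mul_zero]
    rw [Finset.sum_boole]
    congr 2
    ext v
    simp [and_comm]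
  have hbound : ∑ T ∈ L, ∑ T' ∈ L, ((T ∩ T').card : ℝ) ≤ σ + (L.card : ℝ) ^ 2 * l := by
    have : ∀ T ∈ L, ∑ T' ∈ L, ((T ∩ T').card : ℝ) ≤ (T.card : ℝ) + (L.card : ℝ) * l := by
      intro T hT
      rw [← Finset.add_sum_erase L _ hT, Finset.inter_self]
      gcongr
      calc ∑ T' ∈ L.erase T, ((T ∩ T').card : ℝ) ≤ ∑ T' ∈ L.erase T, l :=
            Finset.sum_le_sum fun T' hT' =>
              hinter T hT T' (Finset.mem_of_mem_erase hT') (Finset.ne_of_mem_erase hT').symm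
        _ ≤ ∑ T' ∈ L, l := Finset.sum_le_sum_of_subset_of_nonneg (Finset.erase_subset _ _)
              fun _ _ _ => hl
        _ = (L.card : ℝ) * l := by rw [Finset.sum_const, nsmul_eq_mul]
    calc _ ≤ ∑ T ∈ L, ((T.card : ℝ) + (L.card : ℝ) * l) := Finset.sum_le_sum this
      _ = _ := by rw [Finset.sum_add_distrib, Finset.sum_const, nsmul_eq_mul]; ring
  have hcs : σ ^ 2 ≤ r * (σ + (L.card : ℝ) ^ 2 * l) := by
    calc σ ^ 2 ≤ (Finset.univ : Finset (Fin n)).card *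
          ∑ v : Fin n, (∑ T ∈ L, (if v ∈ T then (1 : ℝ) else 0)) ^ 2 := by
            rw [hdeg]; exact sq_sum_le_card_mul_sum_sq
      _ ≤ r * (σ + (L.card : ℝ) ^ 2 * l) := by
            rw [hsq, Finset.card_univ, Fintype.card_fin, ← hr]
            gcongr
  have hLpos : 0 < (L.card : ℝ) := by
    rcases (Nat.cast_nonneg (α := ℝ) L.card).lt_or_eq with h | h
    · exact h
    · rw [← h] at hlt
      nlinarith
  -- From `σ ≥ |L| s > m s ≥ 2 r`; so the diagonal term `r σ` is at most `σ² / 2` and is absorbed on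
  -- the left.
  have hσ2 : 2 * r ≤ σ := by nlinarith
  have hσ0 : 0 ≤ σ := by linarith
  have h1 : σ ^ 2 ≤ 2 * r * ((L.card : ℝ) ^ 2 * l) := by nlinarith
  have h2 : ((L.card : ℝ) * s) ^ 2 ≤ σ ^ 2 := by gcongr
  have h3 : (L.card : ℝ) ^ 2 * s ^ 2 ≤ (L.card : ℝ) ^ 2 * (2 * r * l) := by nlinarith
  have h4 := le_of_mul_le_mul_left h3 (by positivity)
  linarith

theorem recover_eq_some {u : Fin n} (hu : u ∈ S) (hS : S ∈ prunedList G x)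
    (huniq : ∀ T ∈ prunedList G x, T ≠ S → u ∉ T) : recover G x u = some S := by
  have hex : ∃! T, T ∈ prunedList G x ∧ u ∈ T :=
    ⟨S, ⟨hS, hu⟩, fun T hT => by_contra fun hne => huniq T hT.1 hne hT.2⟩
  rw [recover, dif_pos hex]
  exact congrArg some (hex.unique hex.exists.choose_spec ⟨hS, hu⟩)

-- Recovery fails only for vertices of `S` lying in a second surviving set; there are at most `m`
-- such sets, each meeting `S` in fewer than `2 log₂ n` vertices.
open scoped Classical in
theorem IsPseudorandom.card_recover_ne_le (h : IsPseudorandom G S)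
    (hlog : 6 * Real.logb 2 n ≤ (n : ℝ) ^ (2 / 3 : ℝ)) {m : ℝ}
    (hn : 1 ≤ n) (hm : 2 * (n : ℝ) ≤ m * (n : ℝ) ^ (2 / 3 : ℝ))
    (hlog' : 2 * (n : ℝ) * (2 * Real.logb 2 n) < ((n : ℝ) ^ (2 / 3 : ℝ)) ^ 2)
    (hSL : S ∈ removeSmall (candidateList G x)) :
    ((S.filter fun u => recover G x u ≠ some S).card : ℝ) ≤ m * (2 * Real.logb 2 n) := by
  have hmem := h.mem_prunedList hlog hSL
  have hl0 : 0 ≤ 2 * Real.logb 2 n := by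
    have : 0 ≤ Real.logb 2 n := Real.logb_nonneg (by norm_num) (by exact_mod_cast hn)
    linarith
  have hcard : ((prunedList G x).card : ℝ) ≤ m := by
    refine card_le_of_inter_le (s := (n : ℝ) ^ (2 / 3 : ℝ)) (r := n)
      (Real.rpow_pos_of_pos (by exact_mod_cast hn) _) (fun T hT => ?_)
      (fun T hT T' hT' hne => ?_) hl0 rfl hm hlog'
    · exact (mem_removeSmall.1 (mem_removeMostlyCovered.1 (mem_removeOverlapping.1 hT).1).1).2
    · exact ((mem_removeOverlapping.1 hT).2 T' (mem_removeOverlapping.1 hT').1 hne).le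
  have hsub : (S.filter fun u => recover G x u ≠ some S) ⊆
      ((prunedList G x).erase S).biUnion fun T => S ∩ T := by
    intro u hu
    obtain ⟨huS, hne⟩ := Finset.mem_filter.1 hu
    by_contra hcon
    refine hne (recover_eq_some huS hmem fun T hT hTS huT => hcon ?_)
    exact Finset.mem_biUnion.2 ⟨T, Finset.mem_erase.2 ⟨hTS, hT⟩, Finset.mem_inter.2 ⟨huS, huT⟩⟩
  calc ((S.filter fun u => recover G x u ≠ some S).card : ℝ)
      ≤ ((((prunedList G x).erase S).biUnion fun T => S ∩ T).card : ℝ) := by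
        exact_mod_cast Finset.card_le_card hsub
    _ ≤ ∑ T ∈ (prunedList G x).erase S, ((S ∩ T).card : ℝ) := by
        exact_mod_cast Finset.card_biUnion_le
    _ ≤ ∑ T ∈ (prunedList G x).erase S, (2 * Real.logb 2 n) := by
        refine Finset.sum_le_sum fun T hT => ?_
        obtain ⟨hne, hT⟩ := Finset.mem_erase.1 hT
        exact (h.inter_lt_logb hlog hSL (mem_removeOverlapping.1 hT).1 hne).le
    _ ≤ m * (2 * Real.logb 2 n) := by
        rw [Finset.sum_const, nsmul_eq_mul]
        refine mul_le_mul_of_nonneg_right (le_trans ?_ hcard) hl0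
        exact_mod_cast Finset.card_le_card (Finset.erase_subset _ _)

end Pruning

end

/-! ### Optimal solutions of the crude semidefinite program -/

section

open scoped Classical in
/-- The sign of a vertex pair: `-1` for edges and `1` for non-edges. -/
noncomputable def edgeSign {n : ℕ} (H : SimpleGraph (Fin n)) (u v : Fin n) : ℝ :=
  if H.Adj u v then -1 else 1

/-- The signed bipartite adjacency form between `S` and its complement has norm at most `K`. -/
def CrossFormBound {n : ℕ} (H : SimpleGraph (Fin n)) (S : Finset (Fin n)) (K : ℝ) : Prop :=
  ∀ y z : EuclideanSpace ℝ (Fin n),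
    ∑ u ∈ S, ∑ v ∈ Sᶜ, edgeSign H u v * (y u * z v) ≤ K * (‖y‖ * ‖z‖)

variable {n : ℕ} {G H : SimpleGraph (Fin n)} {x y : VectorAssignment n} {S : Finset (Fin n)}

theorem IsFeasible.norm_eq_one (hx : IsFeasible G x) (u : Fin n) : ‖x u‖ = 1 := by
  exact (pow_eq_one_iff_of_nonneg (norm_nonneg _) two_ne_zero).1 (hx.norm_sq_eq_one u)

theorem IsFeasible.norm_sub_sq (hx : IsFeasible G x) (u v : Fin n) :
    ‖x u - x v‖ ^ 2 = 2 - 2 * inner ℝ (x u) (x v) := by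
  rw [norm_sub_sq_real, hx.norm_sq_eq_one, hx.norm_sq_eq_one]
  ring

theorem IsFeasible.objective_eq (hx : IsFeasible G x) :
    objective x = 2 * (n : ℝ) ^ 2 - 2 * ∑ u, ∑ v, inner ℝ (x u) (x v) := by
  simp only [objective, hx.norm_sub_sq, Finset.sum_sub_distrib, Finset.mul_sum]
  simp
  ring

/-- On unit vectors, minimizing squared distances is the same as maximizing the sum of inner
products. -/
theorem IsOptimal.sum_inner_le (hx : IsOptimal G x) (hy : IsFeasible G y) :
    ∑ u, ∑ v, inner ℝ (y u) (y v) ≤ ∑ u, ∑ v, inner ℝ (x u) (x v) := by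
  have h := hx.objective_le y hy
  rw [hx.feasible.objective_eq, hy.objective_eq] at h
  linarith

theorem sum_sum_eq_of_symm {α : Type*} [Fintype α] [DecidableEq α] (S : Finset α)
    {f : α → α → ℝ} (hf : ∀ u v, f u v = f v u) :
    ∑ u, ∑ v, f u v = ∑ u ∈ S, ∑ v ∈ S, f u v + 2 * ∑ u ∈ S, ∑ v ∈ Sᶜ, f u v +
      ∑ u ∈ Sᶜ, ∑ v ∈ Sᶜ, f u v := by
  have h : ∑ u ∈ Sᶜ, ∑ v ∈ S, f u v = ∑ u ∈ S, ∑ v ∈ Sᶜ, f u v := by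
    rw [Finset.sum_comm]
    exact Finset.sum_congr rfl fun u _ => Finset.sum_congr rfl fun v _ => hf v u
  rw [← Finset.sum_add_sum_compl S]
  simp_rw [← Finset.sum_add_sum_compl S (fun v => f _ v), Finset.sum_add_distrib]
  rw [h]
  ring

/-- A unit vector orthogonal to the vectors of all vertices outside a nonempty set. -/
theorem exists_unit_orthogonal (hS : S.Nonempty) (x : VectorAssignment n) :
    ∃ e : EuclideanSpace ℝ (Fin n), ‖e‖ = 1 ∧ ∀ v ∉ S, inner ℝ e (x v) = 0 := by
  set W : Submodule ℝ (EuclideanSpace ℝ (Fin n)) :=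
    Submodule.span ℝ ((Sᶜ.image x : Finset _) : Set (EuclideanSpace ℝ (Fin n))) with hW
  have hlt : Module.finrank ℝ W < n := by
    calc Module.finrank ℝ W ≤ (Sᶜ.image x).card := finrank_span_finset_le_card _
      _ ≤ Sᶜ.card := Finset.card_image_le
      _ < n := by
        have := hS.card_pos
        have h2 := S.card_le_univ
        rw [Finset.card_compl, Fintype.card_fin] at *
        omega
  have hadd := Submodule.finrank_add_finrank_orthogonal W
  rw [finrank_euclideanSpace, Fintype.card_fin] at hadd
  have hpos : 0 < Module.finrank ℝ Wᗮ := by omega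
  have := Module.nontrivial_of_finrank_pos hpos
  obtain ⟨e, he⟩ := exists_ne (0 : Wᗮ)
  have he' : (e : EuclideanSpace ℝ (Fin n)) ≠ 0 := by simpa using he
  refine ⟨(‖(e : EuclideanSpace ℝ (Fin n))‖)⁻¹ • (e : EuclideanSpace ℝ (Fin n)),
    norm_smul_inv_norm he', fun v hv => ?_⟩
  rw [real_inner_smul_left, real_inner_comm, (Submodule.mem_orthogonal W e).1 e.2 (x v), mul_zero]
  refine Submodule.subset_span ?_
  rw [Finset.mem_coe]
  exact Finset.mem_image_of_mem _ (Finset.mem_compl.2 hv)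

/-- Comparison of an optimal solution with the solution which collapses `S` to a point. -/
theorem IsOptimal.sq_card_le (hx : IsOptimal G x) (hS : G.IsIndepSet (S : Set (Fin n)))
    (hne : S.Nonempty) :
    (S.card : ℝ) ^ 2 ≤ ∑ u ∈ S, ∑ v ∈ S, inner ℝ (x u) (x v) +
      2 * ∑ u ∈ S, ∑ v ∈ Sᶜ, inner ℝ (x u) (x v) := by
  classical
  obtain ⟨e, he, horth⟩ := exists_unit_orthogonal hne x
  -- Feasible because `S` is independent and `e` is orthogonal to all outside vectors. The terms
  -- with both vertices outside `S` are unchanged and cancel in the comparison.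
  set y : VectorAssignment n := fun u => if u ∈ S then e else x u with hy
  have hyS : ∀ u ∈ S, y u = e := fun u hu => if_pos hu
  have hyC : ∀ u ∉ S, y u = x u := fun u hu => if_neg hu
  have hee : inner ℝ e e = (1 : ℝ) := by rw [real_inner_self_eq_norm_sq, he]; norm_num
  have hcross : ∀ u ∈ S, ∀ v ∉ S, inner ℝ (y u) (y v) = 0 := fun u hu v hv => by
    rw [hyS u hu, hyC v hv, horth v hv]
  have hin : ∀ u ∈ S, ∀ v ∈ S, inner ℝ (y u) (y v) = 1 := fun u hu v hv => by
    rw [hyS u hu, hyS v hv, hee]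
  have hfeas : IsFeasible G y := by
    refine ⟨fun u => ?_, fun u v => ?_, fun u v huv => ?_⟩
    · by_cases hu : u ∈ S
      · rw [hyS u hu, he]; norm_num
      · rw [hyC u hu]; exact hx.feasible.norm_sq_eq_one u
    · by_cases hu : u ∈ S <;> by_cases hv : v ∈ S
      · rw [hin u hu v hv]; norm_num
      · rw [hcross u hu v hv]
      · rw [real_inner_comm, hcross v hv u hu]
      · rw [hyC u hu, hyC v hv]; exact hx.feasible.inner_nonneg u v
    · by_cases hu : u ∈ S <;> by_cases hv : v ∈ S
      · exact absurd huv (hS hu hv huv.ne)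
      · exact hcross u hu v hv
      · rw [real_inner_comm, hcross v hv u hu]
      · rw [hyC u hu, hyC v hv]; exact hx.feasible.inner_eq_zero u v huv
  have h := hx.sum_inner_le hfeas
  rw [sum_sum_eq_of_symm S (fun u v => real_inner_comm (y v) (y u)),
    sum_sum_eq_of_symm S (fun u v => real_inner_comm (x v) (x u))] at h
  have h1 : ∑ u ∈ S, ∑ v ∈ S, inner ℝ (y u) (y v) = (S.card : ℝ) ^ 2 := by
    rw [Finset.sum_congr rfl fun u hu => Finset.sum_congr rfl fun v hv => hin u hu v hv]
    simp [sq]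
  have h2 : ∑ u ∈ S, ∑ v ∈ Sᶜ, inner ℝ (y u) (y v) = 0 :=
    Finset.sum_eq_zero fun u hu => Finset.sum_eq_zero fun v hv =>
      hcross u hu v (Finset.mem_compl.1 hv)
  have h3 : ∑ u ∈ Sᶜ, ∑ v ∈ Sᶜ, inner ℝ (y u) (y v) =
      ∑ u ∈ Sᶜ, ∑ v ∈ Sᶜ, inner ℝ (x u) (x v) :=
    Finset.sum_congr rfl fun u hu => Finset.sum_congr rfl fun v hv => by
      rw [hyC u (Finset.mem_compl.1 hu), hyC v (Finset.mem_compl.1 hv)]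
  rw [h1, h2, h3] at h
  linarith

/-- The sign differs from `1` only on edges of `H`, where the constraint makes the inner product
zero. This lets the norm of a random sign matrix control an unsigned sum, whatever edges the
adversary added. -/
theorem IsFeasible.edgeSign_mul_inner (hx : IsFeasible G x) (hHG : H ≤ G) (u v : Fin n) :
    edgeSign H u v * inner ℝ (x u) (x v) = inner ℝ (x u) (x v) := by
  unfold edgeSign
  split_ifs with h
  · rw [hx.inner_eq_zero u v (hHG h), mul_zero]
  · rw [one_mul]

open scoped Classical in
/-- The `j`-th coordinates of the vectors of the vertices in `S`, padded by zeros. -/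
noncomputable def coordinateVector (x : VectorAssignment n) (S : Finset (Fin n)) (j : Fin n) :
    EuclideanSpace ℝ (Fin n) :=
  WithLp.toLp 2 fun u => if u ∈ S then x u j else 0

theorem IsFeasible.sum_norm_coordinateVector_sq (hx : IsFeasible G x) (S : Finset (Fin n)) :
    ∑ j, ‖coordinateVector x S j‖ ^ 2 = S.card := by
  classical
  simp_rw [EuclideanSpace.norm_sq_eq, coordinateVector]
  rw [Finset.sum_comm]
  have : ∀ u : Fin n, ∑ j, ‖(if u ∈ S then x u j else 0 : ℝ)‖ ^ 2 = if u ∈ S then (1 : ℝ) else 0 := by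
    intro u
    by_cases hu : u ∈ S
    · simp only [hu, if_true]
      rw [← EuclideanSpace.norm_sq_eq, hx.norm_sq_eq_one]
    · simp [hu]
  rw [Finset.sum_congr rfl fun u _ => this u]
  simp

/-- The form bound is applied to each coordinate separately and the coordinates are summed by
Cauchy–Schwarz; unit length makes the squared norms add up to `|S|` and `|Sᶜ| ≤ n`. -/
theorem IsFeasible.sum_edgeSign_mul_inner_le (hx : IsFeasible G x) {K : ℝ} (hK : 0 ≤ K)
    (hH : CrossFormBound H S K) :
    ∑ u ∈ S, ∑ v ∈ Sᶜ, edgeSign H u v * inner ℝ (x u) (x v) ≤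
      K * (√(S.card : ℝ) * √(n : ℝ)) := by
  classical
  have h1 : ∑ u ∈ S, ∑ v ∈ Sᶜ, edgeSign H u v * inner ℝ (x u) (x v) =
      ∑ j, ∑ u ∈ S, ∑ v ∈ Sᶜ, edgeSign H u v *
        (coordinateVector x S j u * coordinateVector x Sᶜ j v) := by
    symm
    rw [Finset.sum_comm]
    refine Finset.sum_congr rfl fun u hu => ?_
    rw [Finset.sum_comm]
    refine Finset.sum_congr rfl fun v hv => ?_
    rw [← Finset.mul_sum, PiLp.inner_apply]
    congr 1
    refine Finset.sum_congr rfl fun j _ => ?_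
    simp only [coordinateVector, hu, hv, if_true]
    simp [mul_comm]
  rw [h1]
  calc _ ≤ ∑ j, K * (‖coordinateVector x S j‖ * ‖coordinateVector x Sᶜ j‖) :=
        Finset.sum_le_sum fun j _ => hH _ _
    _ = K * ∑ j, ‖coordinateVector x S j‖ * ‖coordinateVector x Sᶜ j‖ := by rw [Finset.mul_sum]
    _ ≤ K * (√(S.card : ℝ) * √(n : ℝ)) := by
      refine mul_le_mul_of_nonneg_left
        ((Real.sum_mul_le_sqrt_mul_sqrt _ _ _).trans ?_) hK
      rw [hx.sum_norm_coordinateVector_sq, hx.sum_norm_coordinateVector_sq]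
      gcongr
      simpa using Finset.card_le_univ Sᶜ

theorem IsOptimal.sum_one_sub_inner_le (hx : IsOptimal G x)
    (hS : G.IsIndepSet (S : Set (Fin n))) (hne : S.Nonempty) (hHG : H ≤ G) {K : ℝ} (hK : 0 ≤ K)
    (hH : CrossFormBound H S K) :
    ∑ u ∈ S, ∑ v ∈ S, (1 - inner ℝ (x u) (x v)) ≤ 2 * (K * (√(S.card : ℝ) * √(n : ℝ))) := by
  have h1 := hx.sq_card_le hS hne
  have h2 := hx.feasible.sum_edgeSign_mul_inner_le hK hH
  simp_rw [hx.feasible.edgeSign_mul_inner hHG] at h2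
  simp only [Finset.sum_sub_distrib, Finset.sum_const, nsmul_eq_mul, mul_one]
  nlinarith

/-- Some ball of an optimal solution greedily extends to `S`. -/
theorem IsOptimal.mem_candidateList (hx : IsOptimal G x) (hps : IsPseudorandom G S)
    (hne : S.Nonempty) (hHG : H ≤ G) {K : ℝ} (hK : 0 ≤ K) (hH : CrossFormBound H S K)
    (hKS : 48 * (K * (√(S.card : ℝ) * √(n : ℝ))) ≤ (S.card : ℝ) ^ 2) :
    S ∈ candidateList G x := by
  classical
  have hS := hps.isIndepSet
  have hsum := hx.sum_one_sub_inner_le hS hne hHG hK hH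
  -- Averaging: the total defect is at most `|S|² / 24`. By Markov at most `8 |S| / 24 = |S| / 3`
  -- vertices of `S` then have defect above `1/8`, fewer than the neighbours in `S` of any outside
  -- vertex.
  obtain ⟨u, huS, hu⟩ : ∃ u ∈ S, ∑ v ∈ S, (1 - inner ℝ (x u) (x v)) ≤ (S.card : ℝ) / 24 := by
    refine Finset.exists_le_of_sum_le hne ?_
    rw [Finset.sum_const, nsmul_eq_mul]
    nlinarith
  have hle1 : ∀ v w, inner ℝ (x v) (x w) ≤ 1 := fun v w => by
    have := real_inner_le_norm (x v) (x w)
    rwa [hx.feasible.norm_eq_one, hx.feasible.norm_eq_one, one_mul] at this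
  set F := S.filter fun w => 1 / 8 < 1 - inner ℝ (x u) (x w) with hF
  have hFcard : 3 * F.card ≤ S.card := by
    have h1 : (F.card : ℝ) * (1 / 8) ≤ ∑ v ∈ S, (1 - inner ℝ (x u) (x v)) := by
      calc (F.card : ℝ) * (1 / 8) = F.card • (1 / 8 : ℝ) := by rw [nsmul_eq_mul]
        _ ≤ ∑ v ∈ F, (1 - inner ℝ (x u) (x v)) :=
          Finset.card_nsmul_le_sum _ _ _ fun w hw => (Finset.mem_filter.1 hw).2.le
        _ ≤ _ := Finset.sum_le_sum_of_subset_of_nonneg (Finset.filter_subset _ _)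
          fun w _ _ => by linarith [hle1 u w]
    have h2 : (3 : ℝ) * (F.card : ℝ) ≤ (S.card : ℝ) := by linarith
    exact_mod_cast h2
  have hclose : ∀ v ∉ S, ∃ w ∈ S, G.Adj w v ∧ 1 - inner ℝ (x u) (x w) ≤ 1 / 8 := by
    intro v hv
    have hlt := hps.card_lt v hv
    by_contra! hcon
    have hsub : (S.filter fun w => G.Adj w v) ⊆ F := fun w hw =>
      Finset.mem_filter.2 ⟨(Finset.mem_filter.1 hw).1,
        hcon w (Finset.mem_filter.1 hw).1 (Finset.mem_filter.1 hw).2⟩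
    have := Finset.card_le_card hsub
    omega
  have hball : ∀ v, v ∈ vertexBall x u ↔ ‖x v - x u‖ < 1 := fun v => by simp [vertexBall]
  refine SemirandomIndepSet.mem_candidateList.2 ⟨⟨u, greedyExtend_eq hS (fun v hv => ?_)
    fun v hv => ?_⟩, hS⟩
  -- An outside `v` has a neighbour `w` with `‖x u - x w‖ ≤ 1/2`. Since `x v ⟂ x w`, it follows that
  -- `⟨x v, x u⟩ ≤ 1/2`, that is, `‖x v - x u‖ ≥ 1`.
  · by_contra hvS
    obtain ⟨w, -, hwv, hw⟩ := hclose v hvS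
    have h0 := hx.feasible.inner_eq_zero w v hwv
    have h1 := (hball v).1 hv
    have h2 := hx.feasible.norm_sub_sq v u
    have h3 : inner ℝ (x v) (x u) = inner ℝ (x v) (x u - x w) := by
      rw [inner_sub_right, real_inner_comm (x w) (x v), h0, sub_zero]
    have h4 := real_inner_le_norm (x v) (x u - x w)
    rw [hx.feasible.norm_eq_one, one_mul] at h4
    have h5 := hx.feasible.norm_sub_sq u w
    have h6 : ‖x u - x w‖ ≤ 1 / 2 := by
      refine abs_le_of_sq_le_sq' ?_ (by norm_num) |>.2
      linarith
    have h7 : ‖x v - x u‖ ^ 2 < 1 := by nlinarith [norm_nonneg (x v - x u)]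
    linarith
  · obtain ⟨w, hwS, hwv, hw⟩ := hclose v hv
    refine ⟨w, (hball w).2 ?_, hwv.symm⟩
    have h2 := hx.feasible.norm_sub_sq u w
    rw [norm_sub_rev]
    refine lt_of_pow_lt_pow_left₀ 2 (by norm_num) ?_
    linarith

end

/-! ### Operator norms and nets -/

section

/-- The unit ball of a finite-dimensional space has a `1/2`-net of at most `5 ^ dim` points. -/
theorem exists_half_net (E : Type*) [NormedAddCommGroup E] [NormedSpace ℝ E]
    [FiniteDimensional ℝ E] :
    ∃ N : Finset E, N.card ≤ 5 ^ Module.finrank ℝ E ∧ (∀ c ∈ N, ‖c‖ ≤ 1) ∧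
      ∀ y : E, ‖y‖ ≤ 1 → ∃ c ∈ N, ‖y - c‖ ≤ 1 / 2 := by
  classical
  -- A largest `1`-separated set in the ball of radius `2` is a `1`-net of it; halving gives the net
  -- sought. The packing bound `5 ^ dim` makes a largest size exist.
  set P : ℕ → Prop := fun m => ∃ s : Finset E, s.card = m ∧ (∀ c ∈ s, ‖c‖ ≤ 2) ∧
    ∀ c ∈ s, ∀ d ∈ s, c ≠ d → 1 ≤ ‖c - d‖ with hP
  have hP0 : P 0 := ⟨∅, by simp⟩
  have hPle : ∀ m, P m → m ≤ 5 ^ Module.finrank ℝ E := by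
    rintro m ⟨s, rfl, hs, hs'⟩
    exact Besicovitch.card_le_of_separated s hs hs'
  obtain ⟨s, hcard, hs, hsep⟩ : P (Nat.findGreatest P (5 ^ Module.finrank ℝ E)) :=
    Nat.findGreatest_spec (Nat.zero_le _) hP0
  have hmax : ∀ z : E, ‖z‖ ≤ 2 → ∃ c ∈ s, ‖z - c‖ ≤ 1 := by
    intro z hz
    by_contra! hcon
    have hzs : z ∉ s := fun h => by simpa using (hcon z h).trans_le (by simp : ‖z - z‖ ≤ 1)
    have hPs : P (s.card + 1) := by
      refine ⟨insert z s, Finset.card_insert_of_notMem hzs, ?_, ?_⟩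
      · simpa [hz] using hs
      · intro c hc d hd hcd
        rcases Finset.mem_insert.1 hc with hc' | hc' <;>
          rcases Finset.mem_insert.1 hd with hd' | hd'
        · exact absurd (hc'.trans hd'.symm) hcd
        · exact hc' ▸ (hcon d hd').le
        · rw [norm_sub_rev]; exact hd' ▸ (hcon c hc').le
        · exact hsep c hc' d hd' hcd
    have := Nat.le_findGreatest (hPle _ hPs) hPs
    omega
  refine ⟨s.image fun c => (1 / 2 : ℝ) • c, ?_, ?_, ?_⟩
  · exact Finset.card_image_le.trans (Besicovitch.card_le_of_separated s hs hsep)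
  · intro c hc
    obtain ⟨d, hd, rfl⟩ := Finset.mem_image.1 hc
    rw [norm_smul, Real.norm_of_nonneg (by norm_num)]
    linarith [hs d hd]
  · intro y hy
    obtain ⟨c, hc, hcy⟩ := hmax ((2 : ℝ) • y) (by
      rw [norm_smul, Real.norm_of_nonneg (by norm_num)]; linarith)
    refine ⟨(1 / 2 : ℝ) • c, Finset.mem_image_of_mem _ hc, ?_⟩
    have : y - (1 / 2 : ℝ) • c = (1 / 2 : ℝ) • ((2 : ℝ) • y - c) := by
      rw [smul_sub, smul_smul]; norm_num
    rw [this, norm_smul, Real.norm_of_nonneg (by norm_num)]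
    linarith

/-- If a set of vectors meets every ball of radius `1/2` about a point of the unit
ball, then an operator is bounded by four times the supremum of its form on this set. -/
theorem opNorm_le_of_net {E : Type*} [NormedAddCommGroup E] [InnerProductSpace ℝ E]
    (A : E →L[ℝ] E) {N : Set E}
    (hN : ∀ y : E, ‖y‖ ≤ 1 → ∃ c ∈ N, ‖y - c‖ ≤ 1 / 2) {t : ℝ} (ht : 0 ≤ t)
    (hA : ∀ c ∈ N, ∀ d ∈ N, inner ℝ c (A d) ≤ t) : ‖A‖ ≤ 4 * t := by
  have h1 : ∀ d ∈ N, ‖A d‖ ≤ 2 * t := by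
    intro d hd
    rcases eq_or_ne (A d) 0 with h0 | h0
    · rw [h0, norm_zero]; linarith
    have hpos := norm_pos_iff.2 h0
    obtain ⟨c, hc, hcy⟩ := hN (‖A d‖⁻¹ • A d) (norm_smul_inv_norm (𝕜 := ℝ) h0).le
    have h2 : ‖A d‖ = inner ℝ (‖A d‖⁻¹ • A d) (A d) := by
      rw [real_inner_smul_left, real_inner_self_eq_norm_sq]
      field_simp
    have h3 : inner ℝ (‖A d‖⁻¹ • A d) (A d) =
        inner ℝ (‖A d‖⁻¹ • A d - c) (A d) + inner ℝ c (A d) := by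
      rw [inner_sub_left]; ring
    have h4 := real_inner_le_norm (‖A d‖⁻¹ • A d - c) (A d)
    have h5 := hA c hc d hd
    nlinarith
  -- Each of the two arguments of the form is replaced by a net point at the cost of a factor `2`;
  -- here the error `‖A‖ / 2` is absorbed on the left.
  have h2 : ‖A‖ ≤ 2 * t + ‖A‖ * (1 / 2) := by
    refine ContinuousLinearMap.opNorm_le_of_unit_norm (by positivity) fun y hy => ?_
    obtain ⟨c, hc, hcy⟩ := hN y hy.le
    calc ‖A y‖ = ‖A c + A (y - c)‖ := by rw [← map_add]; congr 2; abel
      _ ≤ ‖A c‖ + ‖A (y - c)‖ := norm_add_le _ _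
      _ ≤ 2 * t + ‖A‖ * (1 / 2) :=
        add_le_add (h1 c hc) ((A.le_opNorm _).trans (by gcongr))
  linarith

/-- The bilinear form of a matrix is controlled by its values on a net. -/
theorem sum_mul_mul_le_of_net {n : ℕ} (M : Matrix (Fin n) (Fin n) ℝ)
    {N : Set (EuclideanSpace ℝ (Fin n))}
    (hN : ∀ y : EuclideanSpace ℝ (Fin n), ‖y‖ ≤ 1 → ∃ c ∈ N, ‖y - c‖ ≤ 1 / 2) {t : ℝ} (ht : 0 ≤ t)
    (hM : ∀ c ∈ N, ∀ d ∈ N, ∑ u, ∑ v, M u v * (c u * d v) ≤ t)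
    (y z : EuclideanSpace ℝ (Fin n)) :
    ∑ u, ∑ v, M u v * (y u * z v) ≤ 4 * t * (‖y‖ * ‖z‖) := by
  have key : ∀ y z : EuclideanSpace ℝ (Fin n),
      ∑ u, ∑ v, M u v * (y u * z v) = inner ℝ y (Matrix.toEuclideanCLM (𝕜 := ℝ) M z) := by
    intro y z
    rw [PiLp.inner_apply]
    refine Finset.sum_congr rfl fun u _ => ?_
    rw [Matrix.ofLp_toEuclideanCLM]
    simp only [Matrix.mulVec, dotProduct, RCLike.inner_apply, conj_trivial, Finset.sum_mul]
    exact Finset.sum_congr rfl fun v _ => by ring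
  have hop := opNorm_le_of_net (Matrix.toEuclideanCLM (𝕜 := ℝ) M) hN ht
    fun c hc d hd => (key c d).symm.trans_le (hM c hc d hd)
  rw [key]
  calc inner ℝ y (Matrix.toEuclideanCLM (𝕜 := ℝ) M z)
      ≤ ‖y‖ * ‖Matrix.toEuclideanCLM (𝕜 := ℝ) M z‖ := real_inner_le_norm _ _
    _ ≤ ‖y‖ * (4 * t * ‖z‖) := by
      gcongr
      exact (ContinuousLinearMap.le_opNorm _ _).trans (by gcongr)
    _ = 4 * t * (‖y‖ * ‖z‖) := by ring

theorem crossFormBound_of_net {n : ℕ} {H : SimpleGraph (Fin n)} {S : Finset (Fin n)}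
    {N : Set (EuclideanSpace ℝ (Fin n))}
    (hN : ∀ y : EuclideanSpace ℝ (Fin n), ‖y‖ ≤ 1 → ∃ c ∈ N, ‖y - c‖ ≤ 1 / 2) {t : ℝ} (ht : 0 ≤ t)
    (hM : ∀ c ∈ N, ∀ d ∈ N, ∑ u ∈ S, ∑ v ∈ Sᶜ, edgeSign H u v * (c u * d v) ≤ t) :
    CrossFormBound H S (4 * t) := by
  classical
  have key : ∀ y z : EuclideanSpace ℝ (Fin n),
      ∑ u, ∑ v, Matrix.of (fun u v => if u ∈ S ∧ v ∈ Sᶜ then edgeSign H u v else 0) u v *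
        (y u * z v) = ∑ u ∈ S, ∑ v ∈ Sᶜ, edgeSign H u v * (y u * z v) := by
    intro y z
    simp only [Matrix.of_apply, ite_mul, zero_mul, ite_and]
    rw [← Finset.sum_subset (Finset.subset_univ S) fun u _ hu => by simp [hu]]
    refine Finset.sum_congr rfl fun u hu => ?_
    rw [← Finset.sum_subset (Finset.subset_univ Sᶜ) fun v _ hv => by simp [hv]]
    exact Finset.sum_congr rfl fun v hv => by rw [if_pos hu, if_pos hv]
  intro y z
  rw [← key]
  exact sum_mul_mul_le_of_net _ hN ht (fun c hc d hd => (key c d).trans_le (hM c hc d hd)) y z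

end

/-! ### The random graph -/

section

/-- Makes every event about the random graph measurable, including those depending on the arbitrary
adversary and solution. -/
instance {V : Type*} [Finite V] : DiscreteMeasurableSpace (SimpleGraph V) where
  forall_measurableSet s := by
    have h : s = SimpleGraph.edgeSet ⁻¹' (SimpleGraph.edgeSet '' s) :=
      (Set.preimage_image_eq s SimpleGraph.edgeSet_injective).symm
    rw [h]
    exact SimpleGraph.measurable_edgeSet (Set.toFinite _).measurableSet

variable {n : ℕ} {S : Finset (Fin n)}

/-- The ordered pairs with first vertex in `S` and second vertex outside `S`. -/
def cross (S : Finset (Fin n)) : Finset (Fin n × Fin n) := S ×ˢ Sᶜ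

/-- The unordered pairs underlying a set of ordered pairs. -/
def pairSet (R : Finset (Fin n × Fin n)) : Set (Sym2 (Fin n)) :=
  (fun p : Fin n × Fin n => s(p.1, p.2)) '' (R : Set (Fin n × Fin n))

/-- The graph whose edges are the given pairs. -/
def crossGraph (R : Finset (Fin n × Fin n)) : SimpleGraph (Fin n) :=
  SimpleGraph.fromEdgeSet (pairSet R)

theorem mem_cross {p : Fin n × Fin n} : p ∈ cross S ↔ p.1 ∈ S ∧ p.2 ∉ S := by
  simp [cross]

theorem pairSet_cross (S : Finset (Fin n)) : pairSet (cross S) = boundary S := by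
  ext e
  simp only [pairSet, boundary, Set.mem_image, Finset.mem_coe, mem_cross, Prod.exists,
    Set.mem_ofPred_eq]
  constructor
  · rintro ⟨u, v, ⟨hu, hv⟩, rfl⟩
    exact ⟨u, hu, v, hv, rfl⟩
  · rintro ⟨u, hu, v, hv, rfl⟩
    exact ⟨u, v, ⟨hu, hv⟩, rfl⟩

theorem injOn_cross (S : Finset (Fin n)) :
    Set.InjOn (fun p : Fin n × Fin n => s(p.1, p.2)) (cross S : Set (Fin n × Fin n)) := by
  rintro ⟨u, v⟩ hp ⟨u', v'⟩ hq h
  have hp := mem_cross.1 (Finset.mem_coe.1 hp)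
  have hq := mem_cross.1 (Finset.mem_coe.1 hq)
  rcases Sym2.eq_iff.1 h with ⟨h1, h2⟩ | ⟨h1, h2⟩
  · exact Prod.ext h1 h2
  · simp only at h1 h2 hp hq
    exact absurd (h1 ▸ hp.1) hq.2

theorem mk_mem_pairSet {R : Finset (Fin n × Fin n)} (hR : R ⊆ cross S) {p : Fin n × Fin n}
    (hp : p ∈ cross S) : s(p.1, p.2) ∈ pairSet R ↔ p ∈ R :=
  (injOn_cross S).mem_image_iff (Finset.coe_subset.2 hR) hp

theorem injOn_pairSet (S : Finset (Fin n)) :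
    Set.InjOn pairSet ((cross S).powerset : Set (Finset (Fin n × Fin n))) := by
  intro R hR R' hR' h
  have hR := Finset.mem_powerset.1 (Finset.mem_coe.1 hR)
  have hR' := Finset.mem_powerset.1 (Finset.mem_coe.1 hR')
  ext p
  constructor
  · intro hp
    rw [← mk_mem_pairSet hR' (hR hp), ← h]
    exact (mk_mem_pairSet hR (hR hp)).2 hp
  · intro hp
    rw [← mk_mem_pairSet hR (hR' hp), h]
    exact (mk_mem_pairSet hR' (hR' hp)).2 hp

theorem crossGraph_adj {R : Finset (Fin n × Fin n)} (hR : R ⊆ cross S) {u v : Fin n}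
    (hu : u ∈ S) (hv : v ∉ S) : (crossGraph R).Adj u v ↔ (u, v) ∈ R := by
  rw [crossGraph, SimpleGraph.fromEdgeSet_adj,
    mk_mem_pairSet hR (p := (u, v)) (mem_cross.2 ⟨hu, hv⟩), and_iff_left]
  rintro rfl
  exact hv hu

theorem isIndepSet_crossGraph {R : Finset (Fin n × Fin n)} (hR : R ⊆ cross S) :
    (crossGraph R).IsIndepSet (S : Set (Fin n)) := by
  intro u hu v hv _ hadj
  obtain ⟨⟨⟨a, b⟩, hp, he⟩, -⟩ := (SimpleGraph.fromEdgeSet_adj _).1 hadj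
  have hp := mem_cross.1 (hR hp)
  rcases Sym2.eq_iff.1 he with ⟨rfl, rfl⟩ | ⟨rfl, rfl⟩
  · exact hp.2 hv
  · exact hp.2 hu

instance : IsProbabilityMeasure (randomGraph S) :=
  Measure.isProbabilityMeasure_map SimpleGraph.measurable_fromEdgeSet.aemeasurable

/-- The random graph is the graph of a uniformly random set of pairs between `S` and its
complement. -/
theorem randomGraph_real_apply (S : Finset (Fin n)) (Q : Set (SimpleGraph (Fin n)))
    [DecidablePred fun R => crossGraph R ∈ Q] :
    (randomGraph S).real Q =
      (((cross S).powerset.filter fun R => crossGraph R ∈ Q).card : ℝ) / 2 ^ (cross S).card := by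
  classical
  set F := (cross S).powerset.filter fun R => crossGraph R ∈ Q with hF
  -- The Bernoulli set lies in the boundary almost surely, and `pairSet` identifies subsets of
  -- `cross S` with subsets of the boundary; each has mass `2 ^ (-|cross S|)`.
  have hset : {s ∈ SimpleGraph.fromEdgeSet ⁻¹' Q | s ⊆ boundary S} =
      ((F.image pairSet : Finset (Set (Sym2 (Fin n)))) : Set (Set (Sym2 (Fin n)))) := by
    ext s
    rw [Finset.mem_coe, Finset.mem_image]
    constructor
    · rintro ⟨hs, hsb⟩
      refine ⟨(cross S).filter fun p => s(p.1, p.2) ∈ s, ?_⟩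
      have heq : pairSet ((cross S).filter fun p => s(p.1, p.2) ∈ s) = s := by
        ext e
        constructor
        · rintro ⟨p, hp, rfl⟩
          exact (Finset.mem_filter.1 (Finset.mem_coe.1 hp)).2
        · intro he
          obtain ⟨p, hp, rfl⟩ := (pairSet_cross S).symm ▸ hsb he
          exact ⟨p, Finset.mem_coe.2 (Finset.mem_filter.2 ⟨hp, he⟩), rfl⟩
      refine ⟨Finset.mem_filter.2 ⟨Finset.mem_powerset.2 (Finset.filter_subset _ _), ?_⟩, heq⟩
      rw [crossGraph, heq]
      exact hs
    · rintro ⟨R, hR, rfl⟩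
      obtain ⟨hR, hRQ⟩ := Finset.mem_filter.1 hR
      refine ⟨hRQ, ?_⟩
      rw [← pairSet_cross]
      exact Set.image_mono (Finset.coe_subset.2 (Finset.mem_powerset.1 hR))
  have hcard : (boundary S).ncard = (cross S).card := by
    rw [← pairSet_cross, pairSet, (injOn_cross S).ncard_image, Set.ncard_coe_finset]
  have hsing : ∀ s ∈ F.image pairSet, (setBernoulli (boundary S) half).real {s} =
      1 / 2 ^ (cross S).card := by
    intro s hs
    obtain ⟨R, hR, rfl⟩ := Finset.mem_image.1 hs
    have hsub : pairSet R ⊆ boundary S := by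
      rw [← pairSet_cross]
      exact Set.image_mono (Finset.coe_subset.2
        (Finset.mem_powerset.1 (Finset.mem_filter.1 hR).1))
    rw [setBernoulli_real_singleton half hsub (Set.toFinite _)]
    have h1 : (half : ℝ) = 1 / 2 := rfl
    have h2 := Set.ncard_sdiff_add_ncard_of_subset hsub
    rw [h1, show (1 - 1 / 2 : ℝ) = 1 / 2 by norm_num, ← pow_add, add_comm, h2, hcard,
      one_div_pow]
  rw [randomGraph, map_measureReal_apply SimpleGraph.measurable_fromEdgeSet
    (MeasurableSet.of_discrete), measureReal_def, setBernoulli_apply_eq_apply_subsets, hset,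
    ← measureReal_def, ← sum_measureReal_singleton, Finset.sum_congr rfl hsing, Finset.sum_const,
    Finset.card_image_of_injOn ((injOn_pairSet S).mono
      (Finset.coe_subset.2 (Finset.filter_subset _ _))), nsmul_eq_mul, mul_one_div]

theorem randomGraph_real_not_isIndepSet (S : Finset (Fin n)) :
    (randomGraph S).real {H | ¬ H.IsIndepSet (S : Set (Fin n))} = 0 := by
  classical
  rw [randomGraph_real_apply, Finset.filter_false_of_mem]
  · simp
  · intro R hR h
    exact h (isIndepSet_crossGraph (Finset.mem_powerset.1 hR))

/-- The moment generating function of a signed sum. -/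
theorem sum_powerset_exp {α : Type*} [DecidableEq α] (s : Finset α) (a : α → ℝ) :
    ∑ R ∈ s.powerset, Real.exp (∑ p ∈ s, a p * (if p ∈ R then -1 else 1)) =
      ∏ p ∈ s, (2 * Real.cosh (a p)) := by
  have h : ∀ p, 2 * Real.cosh (a p) = Real.exp (-a p) + Real.exp (a p) := fun p => by
    rw [Real.cosh_eq]; ring
  simp_rw [h]
  rw [Finset.prod_add]
  refine Finset.sum_congr rfl fun R hR => ?_
  rw [Real.exp_sum, ← Finset.prod_sdiff (Finset.mem_powerset.1 hR), mul_comm]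
  congr 1
  · exact Finset.prod_congr rfl fun p hp => by rw [if_pos hp, mul_neg_one]
  · exact Finset.prod_congr rfl fun p hp => by rw [if_neg (Finset.mem_sdiff.1 hp).2, mul_one]

/-- The exponential Markov bound for signed sums over the pairs between `S` and its complement. -/
theorem randomGraph_real_le_exp (S : Finset (Fin n)) (a : Fin n × Fin n → ℝ) (t : ℝ) :
    (randomGraph S).real {H | t ≤ ∑ p ∈ cross S, a p * edgeSign H p.1 p.2} ≤
      Real.exp ((∑ p ∈ cross S, a p ^ 2) / 2 - t) := by
  classical
  rw [randomGraph_real_apply, div_le_iff₀ (by positivity)]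
  have hsign : ∀ R ∈ (cross S).powerset, ∑ p ∈ cross S, a p * edgeSign (crossGraph R) p.1 p.2 =
      ∑ p ∈ cross S, a p * (if p ∈ R then -1 else 1) := by
    intro R hR
    refine Finset.sum_congr rfl fun p hp => ?_
    have hp' := mem_cross.1 hp
    simp only [edgeSign, crossGraph_adj (Finset.mem_powerset.1 hR) hp'.1 hp'.2]
  have h1 : ((((cross S).powerset.filter fun R =>
      crossGraph R ∈ {H | t ≤ ∑ p ∈ cross S, a p * edgeSign H p.1 p.2}).card : ℝ)) * Real.exp t ≤
      ∏ p ∈ cross S, (2 * Real.cosh (a p)) := by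
    rw [← sum_powerset_exp, ← nsmul_eq_mul]
    refine (Finset.card_nsmul_le_sum _
      (fun R => Real.exp (∑ p ∈ cross S, a p * (if p ∈ R then -1 else 1))) _ ?_).trans
      (Finset.sum_le_sum_of_subset_of_nonneg (Finset.filter_subset _ _)
        fun _ _ _ => (Real.exp_pos _).le)
    intro R hR
    obtain ⟨hR, hRt⟩ := Finset.mem_filter.1 hR
    rw [Real.exp_le_exp, ← hsign R hR]
    exact hRt
  have h2 : ∏ p ∈ cross S, (2 * Real.cosh (a p)) ≤
      2 ^ (cross S).card * Real.exp ((∑ p ∈ cross S, a p ^ 2) / 2) := by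
    rw [Finset.sum_div, Real.exp_sum, Finset.prod_mul_distrib, Finset.prod_const]
    gcongr with p hp
    exact Real.cosh_le_exp_half_sq _
  rw [Real.exp_sub, div_mul_eq_mul_div, le_div_iff₀ (Real.exp_pos t)]
  linarith

/-- The probability that there are no edges between two given sets. -/
theorem randomGraph_real_no_edges_le {A B : Finset (Fin n)} (hA : A ⊆ S) (hB : B ⊆ Sᶜ) :
    (randomGraph S).real {H | ∀ a ∈ A, ∀ b ∈ B, ¬ H.Adj a b} ≤ 1 / 2 ^ (A.card * B.card) := by
  classical
  rw [randomGraph_real_apply, div_le_div_iff₀ (by positivity) (by positivity), one_mul]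
  have hAB : A ×ˢ B ⊆ cross S := Finset.product_subset_product hA hB
  have hsub : ((cross S).powerset.filter fun R =>
      crossGraph R ∈ {H : SimpleGraph (Fin n) | ∀ a ∈ A, ∀ b ∈ B, ¬ H.Adj a b}) ⊆
      (cross S \ A ×ˢ B).powerset := by
    intro R hR
    obtain ⟨hR, hRQ⟩ := Finset.mem_filter.1 hR
    have hR := Finset.mem_powerset.1 hR
    refine Finset.mem_powerset.2 fun p hp => Finset.mem_sdiff.2 ⟨hR hp, fun hpAB => ?_⟩
    obtain ⟨ha, hb⟩ := Finset.mem_product.1 hpAB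
    exact hRQ p.1 ha p.2 hb
      ((crossGraph_adj hR (hA ha) (Finset.mem_compl.1 (hB hb))).2 hp)
  have hcard := Finset.card_le_card hsub
  rw [Finset.card_powerset] at hcard
  have h2 := Finset.card_sdiff_add_card_eq_card hAB
  rw [Finset.card_product] at h2
  calc _ ≤ (2 : ℝ) ^ (cross S \ A ×ˢ B).card * 2 ^ (A.card * B.card) := by
        gcongr
        exact_mod_cast hcard
    _ = 2 ^ (cross S).card := by rw [← pow_add, h2]

/-! ### Failure probabilities -/

/-- Union bound over at most `5 ^ n * 5 ^ n` pairs of net points. With the coefficients scaled by `4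
√n`, the sum of squares is at most `16 n` and the threshold is `16 n`, so the exponent is `8 n - 16
n`. -/
theorem randomGraph_real_not_crossFormBound_le (S : Finset (Fin n)) :
    (randomGraph S).real {H | ¬ CrossFormBound H S (16 * √(n : ℝ))} ≤
      25 ^ n * Real.exp (-(8 * n)) := by
  classical
  obtain ⟨N, hcard, hN1, hN⟩ := exists_half_net (EuclideanSpace ℝ (Fin n))
  rw [finrank_euclideanSpace, Fintype.card_fin] at hcard
  have hsub : {H | ¬ CrossFormBound H S (16 * √(n : ℝ))} ⊆
      ⋃ q ∈ N ×ˢ N, {H | 16 * (n : ℝ) ≤ ∑ p ∈ cross S,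
        (4 * √(n : ℝ) * (q.1 p.1 * q.2 p.2)) * edgeSign H p.1 p.2} := by
    intro H hH
    by_contra hcon
    refine hH ?_
    rw [show 16 * √(n : ℝ) = 4 * (4 * √(n : ℝ)) by ring]
    refine crossFormBound_of_net (N := (N : Set _)) hN (by positivity)
      fun c hc d hd => ?_
    by_contra! hlt
    refine hcon (Set.mem_biUnion (x := (c, d)) (Finset.mem_product.2 ⟨hc, hd⟩) ?_)
    have hsum : ∑ p ∈ cross S, (4 * √(n : ℝ) * (c p.1 * d p.2)) * edgeSign H p.1 p.2 =
        4 * √(n : ℝ) * ∑ u ∈ S, ∑ v ∈ Sᶜ, edgeSign H u v * (c u * d v) := by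
      rw [cross, Finset.sum_product, Finset.mul_sum]
      refine Finset.sum_congr rfl fun u _ => ?_
      rw [Finset.mul_sum]
      exact Finset.sum_congr rfl fun v _ => by ring
    rw [Set.mem_ofPred_eq, hsum]
    have hsq : √(n : ℝ) * √(n : ℝ) = n := Real.mul_self_sqrt (Nat.cast_nonneg n)
    nlinarith [Real.sqrt_nonneg (n : ℝ)]
  have hone : ∀ q ∈ N ×ˢ N, (randomGraph S).real {H | 16 * (n : ℝ) ≤ ∑ p ∈ cross S,
        (4 * √(n : ℝ) * (q.1 p.1 * q.2 p.2)) * edgeSign H p.1 p.2} ≤ Real.exp (-(8 * n)) := by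
    intro q hq
    obtain ⟨hc, hd⟩ := Finset.mem_product.1 hq
    refine (randomGraph_real_le_exp S _ _).trans (Real.exp_le_exp.2 ?_)
    have hsum : ∑ p ∈ cross S, (4 * √(n : ℝ) * (q.1 p.1 * q.2 p.2)) ^ 2 ≤ 16 * (n : ℝ) := by
      have h1 : ∀ p : Fin n × Fin n, (4 * √(n : ℝ) * (q.1 p.1 * q.2 p.2)) ^ 2 =
          16 * n * (q.1 p.1 ^ 2 * q.2 p.2 ^ 2) := fun p => by
        rw [mul_pow, mul_pow, Real.sq_sqrt (Nat.cast_nonneg n)]; ring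
      calc _ ≤ ∑ p : Fin n × Fin n, (4 * √(n : ℝ) * (q.1 p.1 * q.2 p.2)) ^ 2 :=
            Finset.sum_le_sum_of_subset_of_nonneg (Finset.subset_univ _)
              fun _ _ _ => sq_nonneg _
        _ = 16 * n * (‖q.1‖ ^ 2 * ‖q.2‖ ^ 2) := by
            simp_rw [h1]
            rw [← Finset.mul_sum, EuclideanSpace.norm_sq_eq, EuclideanSpace.norm_sq_eq,
              Finset.sum_mul_sum, Fintype.sum_prod_type]
            simp
        _ ≤ 16 * n * (1 ^ 2 * 1 ^ 2) := by
            gcongr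
            · exact hN1 _ hc
            · exact hN1 _ hd
        _ = 16 * n := by ring
    linarith
  calc _ ≤ (randomGraph S).real (⋃ q ∈ N ×ˢ N, {H | 16 * (n : ℝ) ≤ ∑ p ∈ cross S,
        (4 * √(n : ℝ) * (q.1 p.1 * q.2 p.2)) * edgeSign H p.1 p.2}) := measureReal_mono hsub (measure_ne_top _ _)
    _ ≤ ∑ q ∈ N ×ˢ N, (randomGraph S).real {H | 16 * (n : ℝ) ≤ ∑ p ∈ cross S,
        (4 * √(n : ℝ) * (q.1 p.1 * q.2 p.2)) * edgeSign H p.1 p.2} :=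
        measureReal_biUnion_finset_le _ _
    _ ≤ (N ×ˢ N).card • Real.exp (-(8 * n)) := Finset.sum_le_card_nsmul _ _ _ hone
    _ ≤ 25 ^ n * Real.exp (-(8 * n)) := by
        rw [nsmul_eq_mul]
        gcongr
        have : (N ×ˢ N).card ≤ 25 ^ n := by
          rw [Finset.card_product, show 25 = 5 * 5 by norm_num, mul_pow]
          exact Nat.mul_le_mul hcard hcard
        exact_mod_cast this

-- Few neighbours make the sum of the signs at `v` at least `|S| / 3`. The weight `1/3` gives
-- threshold `|S| / 9` against half the sum of squares, `|S| / 18`.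
open scoped Classical in
theorem randomGraph_real_exists_few_neighbors_le (S : Finset (Fin n)) :
    (randomGraph S).real {H | ∃ v ∉ S, 3 * (S.filter fun u => H.Adj u v).card ≤ S.card} ≤
      n * Real.exp (-(S.card / 18)) := by
  have hsub : {H : SimpleGraph (Fin n) |
        ∃ v ∉ S, 3 * (S.filter fun u => H.Adj u v).card ≤ S.card} ⊆
      ⋃ v ∈ Sᶜ, {H | (S.card : ℝ) / 9 ≤ ∑ p ∈ cross S,
        (if p.2 = v then 1 / 3 else 0) * edgeSign H p.1 p.2} := by
    rintro H ⟨v, hv, hdeg⟩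
    refine Set.mem_biUnion (Finset.mem_compl.2 hv) ?_
    have hsum : ∑ p ∈ cross S, (if p.2 = v then 1 / 3 else 0) * edgeSign H p.1 p.2 =
        1 / 3 * ∑ u ∈ S, edgeSign H u v := by
      rw [cross, Finset.sum_product, Finset.mul_sum]
      refine Finset.sum_congr rfl fun u _ => ?_
      simp [hv]
    have hsign : ∑ u ∈ S, edgeSign H u v =
        S.card - 2 * ((S.filter fun u => H.Adj u v).card : ℝ) := by
      have : ∀ u, edgeSign H u v = 1 - 2 * (if H.Adj u v then (1 : ℝ) else 0) := fun u => by
        unfold edgeSign; split_ifs <;> norm_num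
      simp_rw [this]
      rw [Finset.sum_sub_distrib, ← Finset.mul_sum, Finset.sum_boole]
      simp
    rw [Set.mem_ofPred_eq, hsum, hsign]
    have : (3 : ℝ) * ((S.filter fun u => H.Adj u v).card : ℝ) ≤ S.card := by exact_mod_cast hdeg
    linarith
  have hone : ∀ v ∈ Sᶜ, (randomGraph S).real {H | (S.card : ℝ) / 9 ≤ ∑ p ∈ cross S,
        (if p.2 = v then 1 / 3 else 0) * edgeSign H p.1 p.2} ≤ Real.exp (-(S.card / 18)) := by
    intro v hv
    refine (randomGraph_real_le_exp S _ _).trans (Real.exp_le_exp.2 ?_)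
    have hsum : ∑ p ∈ cross S, (if p.2 = v then (1 / 3 : ℝ) else 0) ^ 2 = S.card * (1 / 9) := by
      rw [cross, Finset.sum_product, ← nsmul_eq_mul, ← Finset.sum_const]
      refine Finset.sum_congr rfl fun u _ => ?_
      simp [ite_pow, Finset.mem_compl.1 hv]
      norm_num
    rw [hsum]
    linarith
  calc _ ≤ _ := measureReal_mono hsub (measure_ne_top _ _)
    _ ≤ _ := measureReal_biUnion_finset_le _ _
    _ ≤ Sᶜ.card • Real.exp (-(S.card / 18)) := Finset.sum_le_card_nsmul _ _ _ hone
    _ ≤ n * Real.exp (-(S.card / 18)) := by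
        rw [nsmul_eq_mul]
        gcongr
        simpa using Finset.card_le_univ Sᶜ

/-- It suffices to treat parts of size exactly `m`. By AM–GM there are at most `(|S| |Sᶜ|) ^ m ≤ (n²
/ 4) ^ m` choices, so the `m²` missing edges outweigh them by `4 ^ m`. -/
theorem randomGraph_real_exists_empty_biclique_le (S : Finset (Fin n)) {m : ℕ}
    (hm : (n : ℝ) ^ 2 ≤ 2 ^ m) :
    (randomGraph S).real {H | ∃ A ⊆ S, ∃ B ⊆ Sᶜ, m ≤ A.card ∧ m ≤ B.card ∧
      ∀ a ∈ A, ∀ b ∈ B, ¬ H.Adj a b} ≤ (1 / 4) ^ m := by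
  classical
  have hsub : {H : SimpleGraph (Fin n) | ∃ A ⊆ S, ∃ B ⊆ Sᶜ, m ≤ A.card ∧ m ≤ B.card ∧
      ∀ a ∈ A, ∀ b ∈ B, ¬ H.Adj a b} ⊆ ⋃ q ∈ S.powersetCard m ×ˢ Sᶜ.powersetCard m,
        {H | ∀ a ∈ q.1, ∀ b ∈ q.2, ¬ H.Adj a b} := by
    rintro H ⟨A, hA, B, hB, hAm, hBm, hAB⟩
    obtain ⟨A', hA', hA'm⟩ := Finset.exists_subset_card_eq hAm
    obtain ⟨B', hB', hB'm⟩ := Finset.exists_subset_card_eq hBm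
    exact Set.mem_biUnion (x := (A', B')) (Finset.mem_product.2
      ⟨Finset.mem_powersetCard.2 ⟨hA'.trans hA, hA'm⟩,
        Finset.mem_powersetCard.2 ⟨hB'.trans hB, hB'm⟩⟩)
      fun a ha b hb => hAB a (hA' ha) b (hB' hb)
  have hone : ∀ q ∈ S.powersetCard m ×ˢ Sᶜ.powersetCard m,
      (randomGraph S).real {H | ∀ a ∈ q.1, ∀ b ∈ q.2, ¬ H.Adj a b} ≤ 1 / 2 ^ (m * m) := by
    intro q hq
    obtain ⟨h1, h2⟩ := Finset.mem_product.1 hq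
    obtain ⟨hA, hAm⟩ := Finset.mem_powersetCard.1 h1
    obtain ⟨hB, hBm⟩ := Finset.mem_powersetCard.1 h2
    have := randomGraph_real_no_edges_le hA hB
    rwa [hAm, hBm] at this
  have hcard : ((S.powersetCard m ×ˢ Sᶜ.powersetCard m).card : ℝ) ≤ (2 ^ m / 4) ^ m := by
    rw [Finset.card_product, Finset.card_powersetCard, Finset.card_powersetCard]
    have h1 : ((S.card.choose m * Sᶜ.card.choose m : ℕ) : ℝ) ≤
        ((S.card : ℝ) * (Sᶜ.card : ℝ)) ^ m := by
      rw [mul_pow]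
      exact_mod_cast Nat.mul_le_mul (Nat.choose_le_pow _ _) (Nat.choose_le_pow _ _)
    refine h1.trans ?_
    have h2 : (S.card : ℝ) + (Sᶜ.card : ℝ) = n := by
      have := Finset.card_add_card_compl S
      rw [Fintype.card_fin] at this
      exact_mod_cast this
    gcongr
    nlinarith [sq_nonneg ((S.card : ℝ) - (Sᶜ.card : ℝ))]
  calc _ ≤ _ := measureReal_mono hsub (measure_ne_top _ _)
    _ ≤ _ := measureReal_biUnion_finset_le _ _
    _ ≤ (S.powersetCard m ×ˢ Sᶜ.powersetCard m).card • (1 / 2 ^ (m * m) : ℝ) :=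
        Finset.sum_le_card_nsmul _ _ _ hone
    _ ≤ (2 ^ m / 4) ^ m * (1 / 2 ^ (m * m)) := by
        rw [nsmul_eq_mul]
        gcongr
    _ = (1 / 4) ^ m := by
        rw [div_pow, ← pow_mul, one_div_pow]
        field_simp

end

/-! ### Recovery with high probability -/

section

variable {n : ℕ} {S : Finset (Fin n)}

/-- An event of a product space is likely if it is likely on most sections. -/
theorem one_sub_le_prod_real {α β : Type*} [MeasurableSpace α] [MeasurableSpace β]
    [DiscreteMeasurableSpace (α × β)] [DiscreteMeasurableSpace α]
    (μ : Measure α) (ν : Measure β) [IsProbabilityMeasure μ] [IsProbabilityMeasure ν]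
    {Q : Set (α × β)} {s : Set α} {ε₁ ε₂ : ℝ} (hε₁ : 0 ≤ ε₁) (hε₂ : 0 ≤ ε₂)
    (hs : μ.real sᶜ ≤ ε₁) (hQ : ∀ a ∈ s, ν.real {b | (a, b) ∉ Q} ≤ ε₂) :
    1 - (ε₁ + ε₂) ≤ (μ.prod ν).real Q := by
  classical
  have hle : (μ.prod ν).real Qᶜ ≤ ε₁ + ε₂ := by
    refine ENNReal.toReal_le_of_le_ofReal (by positivity) ?_
    rw [Measure.prod_apply MeasurableSet.of_discrete]
    calc ∫⁻ a, ν (Prod.mk a ⁻¹' Qᶜ) ∂μ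
        ≤ ∫⁻ a, (sᶜ.indicator 1 a + ENNReal.ofReal ε₂) ∂μ := by
          refine lintegral_mono fun a => ?_
          by_cases ha : a ∈ s
          · refine le_add_left ?_
            rw [← ofReal_measureReal]
            exact ENNReal.ofReal_le_ofReal (hQ a ha)
          · refine le_add_right ?_
            rw [Set.indicator_of_mem (show a ∈ sᶜ from ha)]
            exact prob_le_one
      _ = μ sᶜ + ENNReal.ofReal ε₂ := by
          rw [lintegral_add_right _ measurable_const, lintegral_indicator_one
            MeasurableSet.of_discrete, lintegral_const, measure_univ, mul_one]
      _ ≤ ENNReal.ofReal (ε₁ + ε₂) := by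
          rw [ENNReal.ofReal_add hε₁ hε₂, ← ofReal_measureReal]
          gcongr
  rw [probReal_compl_eq_one_sub MeasurableSet.of_discrete] at hle
  linarith

theorem uniformOn_real_eq (p : Fin n → Prop) [DecidablePred p] :
    (uniformOn (S : Set (Fin n))).real {u | p u} = ((S.filter p).card : ℝ) / S.card := by
  have h : {u | p u} = ((Finset.univ.filter p : Finset (Fin n)) : Set (Fin n)) := by simp
  rw [h, measureReal_def, uniformOn_apply_finset, ENNReal.toReal_div, ENNReal.toReal_natCast,
    ENNReal.toReal_natCast]
  congr 3
  ext u
  simp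

open scoped Classical in
/-- The event that the random graph is suitable for recovery. -/
structure IsGoodGraph (H : SimpleGraph (Fin n)) (S : Finset (Fin n)) : Prop where
  isIndepSet : H.IsIndepSet (S : Set (Fin n))
  crossFormBound : CrossFormBound H S (16 * √(n : ℝ))
  card_lt : ∀ v ∉ S, S.card < 3 * (S.filter fun u => H.Adj u v).card
  exists_adj : ∀ A ⊆ S, ∀ B ⊆ Sᶜ, ⌈2 * Real.logb 2 n⌉₊ ≤ A.card →
    ⌈2 * Real.logb 2 n⌉₊ ≤ B.card → ∃ a ∈ A, ∃ b ∈ B, H.Adj a b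

theorem sq_le_two_pow_ceil (hn : 1 ≤ n) : (n : ℝ) ^ 2 ≤ 2 ^ ⌈2 * Real.logb 2 n⌉₊ := by
  have hpos : (0 : ℝ) < n := by exact_mod_cast hn
  calc (n : ℝ) ^ 2 = (2 : ℝ) ^ (2 * Real.logb 2 n) := by
        rw [mul_comm, Real.rpow_mul (by norm_num), Real.rpow_logb (by norm_num) (by norm_num) hpos]
        norm_num
    _ ≤ (2 : ℝ) ^ ((⌈2 * Real.logb 2 n⌉₊ : ℕ) : ℝ) :=
        Real.rpow_le_rpow_of_exponent_le (by norm_num) (Nat.le_ceil _)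
    _ = 2 ^ ⌈2 * Real.logb 2 n⌉₊ := Real.rpow_natCast _ _

theorem randomGraph_real_not_isGoodGraph_le (hn : 1 ≤ n) (S : Finset (Fin n)) :
    (randomGraph S).real {H | IsGoodGraph H S}ᶜ ≤ 25 ^ n * Real.exp (-(8 * n)) +
      n * Real.exp (-(S.card / 18)) + (1 / 4) ^ ⌈2 * Real.logb 2 n⌉₊ := by
  classical
  set E₁ : Set (SimpleGraph (Fin n)) := {H | ¬ H.IsIndepSet (S : Set (Fin n))}
  set E₂ : Set (SimpleGraph (Fin n)) := {H | ¬ CrossFormBound H S (16 * √(n : ℝ))}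
  set E₃ : Set (SimpleGraph (Fin n)) :=
    {H | ∃ v ∉ S, 3 * (S.filter fun u => H.Adj u v).card ≤ S.card} with hE₃
  set E₄ : Set (SimpleGraph (Fin n)) := {H | ∃ A ⊆ S, ∃ B ⊆ Sᶜ,
    ⌈2 * Real.logb 2 n⌉₊ ≤ A.card ∧ ⌈2 * Real.logb 2 n⌉₊ ≤ B.card ∧
      ∀ a ∈ A, ∀ b ∈ B, ¬ H.Adj a b}
  have hsub : {H | IsGoodGraph H S}ᶜ ⊆ E₁ ∪ E₂ ∪ E₃ ∪ E₄ := by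
    intro H hH
    by_contra hcon
    simp only [Set.mem_union, not_or] at hcon
    obtain ⟨⟨⟨h1, h2⟩, h3⟩, h4⟩ := hcon
    refine hH ⟨not_not.1 h1, not_not.1 h2, fun v hv => ?_, fun A hA B hB hAm hBm => ?_⟩
    · by_contra! hle
      refine h3 ⟨v, hv, ?_⟩
      convert hle
    · by_contra! hno
      exact h4 ⟨A, hA, B, hB, hAm, hBm, hno⟩
  have h1 : (randomGraph S).real E₁ = 0 := randomGraph_real_not_isIndepSet S
  have h2 : (randomGraph S).real E₂ ≤ _ := randomGraph_real_not_crossFormBound_le S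
  have h3 : (randomGraph S).real E₃ ≤ n * Real.exp (-(S.card / 18)) := by
    convert randomGraph_real_exists_few_neighbors_le S
  have h4 : (randomGraph S).real E₄ ≤ _ :=
    randomGraph_real_exists_empty_biclique_le S (sq_le_two_pow_ceil hn)
  have h5 := measureReal_mono (μ := randomGraph S) hsub (measure_ne_top _ _)
  have h6 := measureReal_union_le (μ := randomGraph S) (E₁ ∪ E₂ ∪ E₃) E₄
  have h7 := measureReal_union_le (μ := randomGraph S) (E₁ ∪ E₂) E₃
  have h8 := measureReal_union_le (μ := randomGraph S) E₁ E₂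
  linarith

/-- Degrees into `S` and edges across the cut can only increase, and no edge appears inside `S`. -/
theorem IsGoodGraph.isPseudorandom {H : SimpleGraph (Fin n)} (hH : IsGoodGraph H S)
    {A : SimpleGraph (Fin n) → SimpleGraph (Fin n)} (hA : IsAdversary S A) :
    IsPseudorandom (A H) S := by
  classical
  refine ⟨fun u hu v hv hne hadj => hH.isIndepSet hu hv hne ((hA H).2 u hu v hv hadj),
    fun v hv => (hH.card_lt v hv).trans_le ?_, fun B hB C hC hBm hCm => ?_⟩
  · gcongr with u hu
    intro h
    exact (hA H).1 h
  · obtain ⟨a, ha, b, hb, hab⟩ := hH.exists_adj B hB C hC (Nat.ceil_le.2 hBm) (Nat.ceil_le.2 hCm)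
    exact ⟨a, ha, b, hb, (hA H).1 hab⟩

theorem exp_mul_pow_le (hn : 1 ≤ n) : (25 : ℝ) ^ n * Real.exp (-(8 * n)) ≤ 1 / n := by
  have hpos : (0 : ℝ) < n := by exact_mod_cast hn
  have h25 : (25 : ℝ) ≤ Real.exp 7 := by
    have h1 : (2 : ℝ) ≤ Real.exp 1 := by linarith [Real.add_one_le_exp (1 : ℝ)]
    calc (25 : ℝ) ≤ 2 ^ 7 := by norm_num
      _ ≤ Real.exp 1 ^ 7 := by gcongr
      _ = Real.exp 7 := by rw [← Real.exp_nat_mul]; norm_num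
  calc (25 : ℝ) ^ n * Real.exp (-(8 * n)) ≤ Real.exp 7 ^ n * Real.exp (-(8 * n)) := by gcongr
    _ = Real.exp (-n) := by rw [← Real.exp_nat_mul, ← Real.exp_add]; ring_nf
    _ = 1 / Real.exp n := by rw [Real.exp_neg, one_div]
    _ ≤ 1 / n := by
      gcongr
      linarith [Real.add_one_le_exp (n : ℝ)]

/-- Deterministic recovery on good graphs. -/
theorem IsGoodGraph.card_recover_ne_le {H : SimpleGraph (Fin n)} (hH : IsGoodGraph H S)
    {A : SimpleGraph (Fin n) → SimpleGraph (Fin n)} (hA : IsAdversary S A)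
    {x : VectorAssignment n} (hx : IsOptimal (A H) x) (hn : 1 ≤ n)
    [DecidablePred fun u => recover (A H) x u ≠ some S]
    (hS : 100 * (n : ℝ) ^ (2 / 3 : ℝ) ≤ S.card)
    (hlog : 6 * Real.logb 2 n ≤ (n : ℝ) ^ (1 / 3 : ℝ)) :
    ((S.filter fun u => recover (A H) x u ≠ some S).card : ℝ) ≤
      4 * ((n : ℝ) ^ (1 / 3 : ℝ) * Real.logb 2 n) := by
  have hn1 : (1 : ℝ) ≤ n := by exact_mod_cast hn
  set a : ℝ := (n : ℝ) ^ (1 / 3 : ℝ) with ha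
  have ha1 : 1 ≤ a := Real.one_le_rpow hn1 (by norm_num)
  have ha2 : (n : ℝ) ^ (2 / 3 : ℝ) = a ^ 2 := by
    rw [ha, ← Real.rpow_natCast, ← Real.rpow_mul (by linarith)]; norm_num
  have ha3 : (n : ℝ) = a ^ 3 := by
    rw [ha, ← Real.rpow_natCast, ← Real.rpow_mul (by linarith)]; norm_num
  have hL : 0 ≤ Real.logb 2 n := Real.logb_nonneg (by norm_num) hn1
  have hps := hH.isPseudorandom hA
  rw [ha2] at hS
  have hk : (0 : ℝ) < S.card := by nlinarith
  have hne : S.Nonempty := Finset.card_pos.1 (by exact_mod_cast hk)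
  have hcand : S ∈ candidateList (A H) x := by
    refine hx.mem_candidateList hps hne (hA H).1 (by positivity) hH.crossFormBound ?_
    set q := √(S.card : ℝ) with hq
    have hq2 : (S.card : ℝ) = q ^ 2 := (Real.sq_sqrt hk.le).symm
    have hq10 : 10 * a ≤ q := Real.le_sqrt_of_sq_le (by nlinarith)
    have hsn : √(n : ℝ) * √(n : ℝ) = a ^ 3 := by rw [Real.mul_self_sqrt (by linarith), ha3]
    -- Here the constant `100` matters: `|S| ≥ 100 a²` gives `q ≥ 10 a`, and `48 * 16 = 768 ≤ 10 ^
    -- 3`.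
    calc 48 * (16 * √(n : ℝ) * (q * √(n : ℝ))) = 768 * (√(n : ℝ) * √(n : ℝ)) * q := by ring
      _ = 768 * a ^ 3 * q := by rw [hsn]
      _ ≤ (10 * a) ^ 3 * q := by
        refine mul_le_mul_of_nonneg_right ?_ (Real.sqrt_nonneg _)
        rw [mul_pow]
        exact mul_le_mul_of_nonneg_right (by norm_num) (by positivity)
      _ ≤ q ^ 3 * q :=
        mul_le_mul_of_nonneg_right (pow_le_pow_left₀ (by positivity) hq10 3) (Real.sqrt_nonneg _)
      _ = (S.card : ℝ) ^ 2 := by rw [hq2]; ring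
  have hSL : S ∈ removeSmall (candidateList (A H) x) :=
    mem_removeSmall.2 ⟨hcand, by rw [ha2]; nlinarith⟩
  -- With `n = a³` and sets of size at least `a²`, the choice `m = 2 a` makes `2 n = m a²` exact.
  have hcount := hps.card_recover_ne_le (m := 2 * a) (by rw [ha2]; nlinarith) hn
    (by rw [ha2, ha3]; exact le_of_eq (by ring))
    (by
      have h3 : 0 < a ^ 3 := by positivity
      have h4 : a ^ 3 * (6 * Real.logb 2 n) ≤ a ^ 3 * a := mul_le_mul_of_nonneg_left hlog h3.le
      have h5 : 0 < a ^ 3 * a := by positivity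
      calc 2 * (n : ℝ) * (2 * Real.logb 2 n) = 2 / 3 * (a ^ 3 * (6 * Real.logb 2 n)) := by
            nth_rewrite 1 [ha3]; ring
        _ < a ^ 3 * a := by linarith
        _ = ((n : ℝ) ^ (2 / 3 : ℝ)) ^ 2 := by rw [ha2]; ring)
    hSL
  calc _ ≤ 2 * a * (2 * Real.logb 2 n) := by convert hcount
    _ = _ := by ring

theorem failure_probability_le (hn : 1 ≤ n) (hS : 100 * (n : ℝ) ^ (2 / 3 : ℝ) ≤ S.card) :
    (25 : ℝ) ^ n * Real.exp (-(8 * n)) + n * Real.exp (-(S.card / 18)) +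
      (1 / 4) ^ ⌈2 * Real.logb 2 n⌉₊ ≤ 8 / n := by
  have hn1 : (1 : ℝ) ≤ n := by exact_mod_cast hn
  have hpos : (0 : ℝ) < n := by linarith
  have h2 : n * Real.exp (-(S.card / 18)) ≤ 6 / n := by
    set b : ℝ := (n : ℝ) ^ (2 / 3 : ℝ) with hb
    have hb0 : 0 ≤ b := by positivity
    have hb3 : b ^ 3 = (n : ℝ) ^ 2 := by
      rw [hb, ← Real.rpow_natCast, ← Real.rpow_mul hpos.le, ← Real.rpow_natCast]; norm_num
    -- Since `100 / 18 ≥ 1`, the exponent is at least `b = n^(2/3)`; the cubic term of the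
    -- exponential series is then `n² / 6`.
    have hexp : (n : ℝ) ^ 2 / 6 ≤ Real.exp (S.card / 18) := by
      calc (n : ℝ) ^ 2 / 6 = b ^ 3 / (Nat.factorial 3 : ℝ) := by rw [hb3]; norm_num [Nat.factorial]
        _ ≤ Real.exp b := Real.pow_div_factorial_le_exp b hb0 3
        _ ≤ _ := Real.exp_le_exp.2 (by linarith)
    rw [Real.exp_neg, ← div_eq_mul_inv, div_le_div_iff₀ (Real.exp_pos _) hpos]
    nlinarith
  have h3 : (1 / 4 : ℝ) ^ ⌈2 * Real.logb 2 n⌉₊ ≤ 1 / n := by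
    calc (1 / 4 : ℝ) ^ ⌈2 * Real.logb 2 n⌉₊ ≤ (1 / 2) ^ ⌈2 * Real.logb 2 n⌉₊ := by
          gcongr; norm_num
      _ = 1 / 2 ^ ⌈2 * Real.logb 2 n⌉₊ := one_div_pow _ _
      _ ≤ 1 / (n : ℝ) ^ 2 := one_div_le_one_div_of_le (by positivity) (sq_le_two_pow_ceil hn)
      _ ≤ 1 / n := one_div_le_one_div_of_le hpos (by nlinarith)
  calc _ ≤ 1 / (n : ℝ) + 6 / n + 1 / n := add_le_add (add_le_add (exp_mul_pow_le hn) h2) h3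
    _ = 8 / n := by ring

theorem eventually_logb_le {ε : ℝ} (hε : 0 < ε) :
    ∀ᶠ n : ℕ in Filter.atTop, Real.logb 2 n ≤ ε * (n : ℝ) ^ (1 / 3 : ℝ) := by
  have hlog2 : 0 < Real.log 2 := Real.log_pos (by norm_num)
  have h := (isLittleO_log_rpow_atTop (r := 1 / 3) (by norm_num)).bound
    (c := ε * Real.log 2) (by positivity)
  filter_upwards [tendsto_natCast_atTop_atTop.eventually h] with n hn
  rw [Real.logb, div_le_iff₀ hlog2]
  rw [Real.norm_eq_abs, Real.norm_of_nonneg (by positivity)] at hn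
  calc Real.log n ≤ |Real.log n| := le_abs_self _
    _ ≤ _ := hn
    _ = _ := by ring

end

end SemirandomIndepSet

theorem theorem2 :
    ∃ c₁ : ℝ, 0 < c₁ ∧ ∀ δ : ℝ, 0 < δ → ∃ N : ℕ, ∀ n : ℕ, N ≤ n → ∀ k : ℕ,
      c₁ * (n : ℝ) ^ (2 / 3 : ℝ) ≤ (k : ℝ) →
      ∀ S : Finset (Fin n), S.card = k →
      ∀ A : SimpleGraph (Fin n) → SimpleGraph (Fin n), SemirandomIndepSet.IsAdversary S A →
      ∀ sol : SimpleGraph (Fin n) → SemirandomIndepSet.VectorAssignment n,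
        (∀ G, SemirandomIndepSet.IsOptimal G (sol G)) →
        1 - δ ≤ (SemirandomIndepSet.inputLaw S).real
          {p | SemirandomIndepSet.recover (A p.1) (sol (A p.1)) p.2 = some S} := by
  classical
  refine ⟨100, by norm_num, fun δ hδ => ?_⟩
  -- The bound `1/6` serves the pruning, `δ` the final fraction of bad vertices, and `n ≥ 16 / δ`
  -- makes the failure probability `8 / n` at most `δ / 2`.
  have hev := (SemirandomIndepSet.eventually_logb_le (lt_min (by norm_num : (0 : ℝ) < 1 / 6) hδ)).and
    ((Filter.eventually_ge_atTop 1).and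
      (tendsto_natCast_atTop_atTop.eventually_ge_atTop (16 / δ)))
  obtain ⟨N, hN⟩ := Filter.eventually_atTop.1 hev
  refine ⟨N, fun n hn k hk S hSk A hA sol hsol => ?_⟩
  obtain ⟨hlog, hn1, hnδ⟩ := hN n hn
  subst hSk
  have hnpos : (0 : ℝ) < n := by exact_mod_cast hn1
  set a : ℝ := (n : ℝ) ^ (1 / 3 : ℝ) with ha
  have ha0 : 0 < a := Real.rpow_pos_of_pos hnpos _
  have ha2 : (n : ℝ) ^ (2 / 3 : ℝ) = a ^ 2 := by
    rw [ha, ← Real.rpow_natCast, ← Real.rpow_mul hnpos.le]; norm_num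
  have hlog6 : Real.logb 2 n ≤ 1 / 6 * a :=
    hlog.trans (mul_le_mul_of_nonneg_right (min_le_left _ _) ha0.le)
  have hlogδ : Real.logb 2 n ≤ δ * a :=
    hlog.trans (mul_le_mul_of_nonneg_right (min_le_right _ _) ha0.le)
  have hk0 : (0 : ℝ) < S.card := by rw [ha2] at hk; nlinarith [pow_pos ha0 2]
  have hne : S.Nonempty := Finset.card_pos.1 (by exact_mod_cast hk0)
  have := isProbabilityMeasure_uniformOn (Ω := Fin n) S.finite_toSet (Finset.coe_nonempty.2 hne)
  have hmain := SemirandomIndepSet.one_sub_le_prod_real (SemirandomIndepSet.randomGraph S)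
    (uniformOn (S : Set (Fin n)))
    (Q := {p | SemirandomIndepSet.recover (A p.1) (sol (A p.1)) p.2 = some S})
    (s := {H | SemirandomIndepSet.IsGoodGraph H S})
    (half_pos hδ).le (half_pos hδ).le ?_ ?_
  · rwa [add_halves] at hmain
  · refine (SemirandomIndepSet.randomGraph_real_not_isGoodGraph_le hn1 S).trans
      ((SemirandomIndepSet.failure_probability_le hn1 hk).trans ?_)
    rw [div_le_iff₀ hδ] at hnδ
    rw [div_le_div_iff₀ hnpos two_pos]
    linarith
  · intro H hH
    have hcount := hH.card_recover_ne_le hA (hsol (A H)) hn1 hk (by linarith)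
    have heq := SemirandomIndepSet.uniformOn_real_eq (S := S)
      fun u => SemirandomIndepSet.recover (A H) (sol (A H)) u ≠ some S
    refine heq.trans_le ?_
    rw [div_le_iff₀ hk0]
    rw [ha2] at hk
    -- At most `4 a log₂ n ≤ 4 δ a²` vertices are bad, while `(δ / 2) |S| ≥ 50 δ a²`.
    nlinarith [mul_le_mul_of_nonneg_left hlogδ ha0.le, mul_le_mul_of_nonneg_left hk hδ.le,
      mul_pos hδ (pow_pos ha0 2)]
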